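/- Let $K\ge 1$, let $\alpha,\mu,\phi,S_0,\hat h_f,R>0$, $\rho_1,\dots,\rho_K>0$ and $h_l\neq 0$, and let $h_{pf,1},\dots,h_{pf,K}$ be random variables whose moduli are independent and all have the density $$f(x)=\frac{\phi\,\mu^{\phi/\alpha}x^{\phi-1}}{S_0^{\phi}\hat h_f^{\phi}\Gamma(\mu)}\,\Gamma\!\left(\frac{\alpha\mu-\phi}{\alpha},\frac{\mu x^{\alpha}}{S_0^{\alpha}\hat h_f^{\alpha}}\right),\quad x>0,$$ where $\Gamma(a,x)=\int_x^\infty u^{a-1}e^{-u}\,du$ ($\alpha$-$\mu$ fading with pointing errors). Let $$p_{out,K}=\Pr\Big\{\sum_{k=1}^K\log_2\big(1+\rho_k|h_l|^2|h_{pf,k}|^2\big)<R\Big\}$$ be the outage probability of HARQ-IR after $K$ rounds. Fox's H-function $H^{m,n}_{p,q}\big[z\,\big|\,{(a_1,A_1),\dots,(a_p,A_p)\atop (b_1,B_1),\dots,(b_q,B_q)}\big]$ is $$\frac1{2\pi i}\int_{\gamma-i\infty}^{\gamma+i\infty}\frac{\prod_{j=1}^m\Gamma(b_j+B_js)\prod_{j=1}^n\Gamma(1-a_j-A_js)}{\prod_{j=m+1}^q\Gamma(1-b_j-B_js)\prod_{j=n+1}^p\Gamma(a_j+A_js)}\,z^{-s}\,ds,$$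 where the line $\mathrm{Re}\,s=\gamma$ has the poles of the factors $\Gamma(b_j+B_js)$, $j\le m$, on its left and those of the factors $\Gamma(1-a_j-A_js)$, $j\le n$, on its right. For $\mathrm{Re}\,t>0$ put $$F(t)=\frac1t\prod_{k=1}^K\frac{1}{\Gamma(t)}\,H^{1,3}_{3,2}\!\left[(\rho_k|h_l|^2)^{1/2}\Big(\frac{\mu}{\hat h_f^\alpha S_0^\alpha}\Big)^{-1/\alpha}\,\middle|\,{(1-t,\frac12),\,(1-\mu,\frac1\alpha),\,(1-\phi,1)\atop (0,\frac12),\,(-\phi,1)}\right].$$ Then these H-functions are well defined: a separating line exists, and along every such line the integral converges absolutely, to the same value. For every $c_1<0$, $$p_{out,K}=\Big(\frac{\phi}{2\Gamma(\mu)}\Big)^K\frac1{2\pi i}\int_{-c_1-i\infty}^{-c_1+i\infty}F(t)\,e^{Rt\ln 2}\,dt,$$ where the contour integral converges absolutely. -/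

import Mathlib

open MeasureTheory ProbabilityTheory

noncomputable section

/-- Upper incomplete Gamma function `Γ(a, x) = ∫_x^∞ u^(a-1) e^(-u) du`
(any real `a` when `x > 0`). -/
def upperIncompleteGamma (a x : ℝ) : ℝ :=
  ∫ u in Set.Ioi x, u ^ (a - 1) * Real.exp (-u)

/-- Probability density of the modulus of the combined `α`-`μ` fading and pointing-error
coefficient. It is supported on the positive half-line. -/
def fadingPDF (α μ φ S₀ hf : ℝ) (x : ℝ) : ℝ :=
  if 0 < x then
    φ * μ ^ (φ / α) * x ^ (φ - 1) / (S₀ ^ φ * hf ^ φ * Real.Gamma μ) *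
      upperIncompleteGamma ((α * μ - φ) / α) (μ * x ^ α / (S₀ ^ α * hf ^ α))
  else 0

/-- Accumulated mutual information `∑_k log₂ (1 + ρ_k |h_l|² |h_{pf,k}|²)` after `K` rounds. -/
def mutualInformation {Ω : Type*} {K : ℕ} (ρ : Fin K → ℝ) (hl : ℂ) (hpf : Fin K → Ω → ℂ)
    (ω : Ω) : ℝ :=
  ∑ k, Real.logb 2 (1 + ρ k * ‖hl‖ ^ 2 * ‖hpf k ω‖ ^ 2)

/-- Outage probability: the accumulated mutual information is less than the rate `R`. -/
def outageProbability {Ω : Type*} [MeasurableSpace Ω] (P : Measure Ω) {K : ℕ}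
    (ρ : Fin K → ℝ) (hl : ℂ) (hpf : Fin K → Ω → ℂ) (R : ℝ) : ℝ :=
  P.real {ω | mutualInformation ρ hl hpf ω < R}

/-- The integral `(2πi)⁻¹ ∫ F(s) ds` along the upward vertical line `Re s = c`. -/
def verticalLineIntegral (c : ℝ) (F : ℂ → ℂ) : ℂ :=
  1 / (2 * Real.pi * Complex.I) * ∫ y : ℝ, F (c + y * Complex.I) * Complex.I

/-- Absolute convergence of the integral of `F` along the vertical line `Re s = c`. -/
def IntegrableOnVerticalLine (c : ℝ) (F : ℂ → ℂ) : Prop :=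
  Integrable (fun y : ℝ => F (c + y * Complex.I)) volume

/-- The quotient of Gamma functions in the Mellin-Barnes integral of `H^{m,n}_{p,q}`.
`a j = (a_j, A_j)` are the upper parameters, `b j = (b_j, B_j)` the lower ones, with indices
starting from zero. -/
def foxHKernel (m n : ℕ) {p q : ℕ} (a : Fin p → ℂ × ℝ) (b : Fin q → ℂ × ℝ) (s : ℂ) : ℂ :=
  ((∏ j : Fin q with j.val < m, Complex.Gamma ((b j).1 + (b j).2 * s)) *
      ∏ j : Fin p with j.val < n, Complex.Gamma (1 - (a j).1 - (a j).2 * s)) /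
    ((∏ j : Fin q with m ≤ j.val, Complex.Gamma (1 - (b j).1 - (b j).2 * s)) *
      ∏ j : Fin p with n ≤ j.val, Complex.Gamma ((a j).1 + (a j).2 * s))

/-- The vertical line `Re s = γ` separates the poles: those of `Γ(b_j + B_j s)`, `j ≤ m`, which
are `-(b_j + ν) / B_j`, lie to its left, and those of `Γ(1 - a_j - A_j s)`, `j ≤ n`, which are
`(1 - a_j + ν) / A_j`, lie to its right. -/
def FoxHSeparates (m n : ℕ) {p q : ℕ} (a : Fin p → ℂ × ℝ) (b : Fin q → ℂ × ℝ) (γ : ℝ) : Prop :=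
  (∀ j : Fin q, j.val < m → ∀ ν : ℕ, (-((b j).1 + ν) / (b j).2).re < γ) ∧
    ∀ j : Fin p, j.val < n → ∀ ν : ℕ, γ < ((1 - (a j).1 + ν) / (a j).2).re

open Classical in
/-- Fox's function `H^{m,n}_{p,q}[z | (a_j, A_j); (b_j, B_j)]` as the Mellin-Barnes integral
`(2πi)⁻¹ ∫ Θ(s) z^(-s) ds` along a vertical line which separates the two families of poles
(junk value `0` if there is no such line). -/
def foxH (m n : ℕ) {p q : ℕ} (a : Fin p → ℂ × ℝ) (b : Fin q → ℂ × ℝ) (z : ℂ) : ℂ :=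
  if h : ∃ γ, FoxHSeparates m n a b γ then
    verticalLineIntegral h.choose (fun s => foxHKernel m n a b s * z ^ (-s))
  else 0

/-- The Fox function is well defined at `z`: some vertical line separates the poles, and along
every such line the Mellin-Barnes integral converges absolutely to the value `foxH`. -/
def FoxHWellDefined (m n : ℕ) {p q : ℕ} (a : Fin p → ℂ × ℝ) (b : Fin q → ℂ × ℝ) (z : ℂ) : Prop :=
  (∃ γ, FoxHSeparates m n a b γ) ∧
    ∀ γ, FoxHSeparates m n a b γ →
      IntegrableOnVerticalLine γ (fun s => foxHKernel m n a b s * z ^ (-s)) ∧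
      verticalLineIntegral γ (fun s => foxHKernel m n a b s * z ^ (-s)) = foxH m n a b z

/-- Upper parameters `(1 - t, 1/2), (1 - μ, 1/α), (1 - φ, 1)`. -/
def upperParams (α μ φ : ℝ) (t : ℂ) : Fin 3 → ℂ × ℝ :=
  ![(1 - t, 1 / 2), (1 - (μ : ℂ), 1 / α), (1 - (φ : ℂ), 1)]

/-- Lower parameters `(0, 1/2), (-φ, 1)`. -/
def lowerParams (φ : ℝ) : Fin 2 → ℂ × ℝ :=
  ![(0, 1 / 2), (-(φ : ℂ), 1)]

/-- The argument `(ρ |h_l|²)^(1/2) (μ / (ĥ_f^α S₀^α))^(-1/α)` of the Fox function. -/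
def foxArgument (α μ S₀ hf : ℝ) (hl : ℂ) (ρ : ℝ) : ℝ :=
  (ρ * ‖hl‖ ^ 2) ^ (1 / 2 : ℝ) * (μ / (hf ^ α * S₀ ^ α)) ^ (-1 / α)

/-- The Laplace-domain function
`F(t) = t⁻¹ ∏_k H^{1,3}_{3,2}[z_k | (1-t,1/2),(1-μ,1/α),(1-φ,1); (0,1/2),(-φ,1)] / Γ(t)`. -/
def outageTransform {K : ℕ} (α μ φ S₀ hf : ℝ) (hl : ℂ) (ρ : Fin K → ℝ) (t : ℂ) : ℂ :=
  1 / t * ∏ k, foxH 1 3 (upperParams α μ φ t) (lowerParams φ)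
    (foxArgument α μ S₀ hf hl (ρ k) : ℂ) / Complex.Gamma t

end

/-! Write `κ_k = ρ_k |h_l|²` and `V = ∑ ln(1 + κ_k |h_k|²)`, so that outage is the event `V < R ln
2`. By independence `E exp(-tV)` is the product of the factors `L_k(t) = E (1 + κ_k |h_k|²)^(-t)`,
and Laplace inversion of the distribution function of `V` gives `(2πi)⁻¹ ∫ ∏ L_k(t) / t · e^(vt) dt`
at `v = R ln 2`. It remains to identify `L_k` with the Fox function and to justify both inversions.

Identification: for `Y` with the fading density, the Mellin transform of `x ↦ E (1 + (xY)²)^(-t)` at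
`s` is `E Y^(-s)` times a Beta function. The moment is a constant times `Γ(μ - s/α) / (φ - s)` times
a power of the scale, the Beta factor is `Γ(s/2) Γ(t - s/2) / (2 Γ(t))`, and `1/(φ - s) = Γ(φ -
s)/Γ(1 + φ - s)`. The product is the Mellin-Barnes kernel up to a factor independent of `s`, so
Mellin inversion at `x = √κ_k` (`verticalLineIntegral_foxHKernel_fading`) evaluates the integral on
each separating line. The value does not involve the line, so no contour has to be shifted. Every
Mellin transform here comes from `hasMellin_integral_comp_mul`, Fubini for averages of dilates.
Absolute convergence in `s` comes from the quadratic decay of `Γ(μ - s/α)`.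

Absolute convergence in `t` is the delicate point: `1/t` alone is not integrable on a vertical line,
so some decay of `∏ L_k` is required. One factor decays like a negative power of `|Im t|`
(`norm_fadingLaplace_le_rpow`) and the others are at most 1 in modulus. The decay comes from
`exists_norm_beta_le`, an integration by parts in the Beta integral, inserted under the
Mellin-Barnes integral. Pointwise inversion also needs continuity of the distribution function at
`v`, which holds because `V` has no atoms. -/

/-! ### Mellin transforms of averages of dilates -/

theorem norm_ofReal_cpow_sub_one {x : ℝ} (hx : 0 < x) (s : ℂ) :
    ‖(x : ℂ) ^ (s - 1)‖ = x ^ (s.re - 1) := by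
  rw [Complex.norm_cpow_eq_rpow_re_of_pos hx]; simp

theorem norm_ofReal_cpow_neg {x : ℝ} (hx : 0 < x) (s : ℂ) :
    ‖(x : ℂ) ^ (-s)‖ = x ^ (-s.re) := by
  rw [Complex.norm_cpow_eq_rpow_re_of_pos hx]; simp

/-- Mellin transform of a superposition of dilates. -/
theorem hasMellin_integral_comp_mul {Ω : Type*} [MeasurableSpace Ω] {P : Measure Ω} [SFinite P]
    {g : Ω → ℂ} {W : Ω → ℝ} {ψ : ℝ → ℂ} {s m : ℂ} (hW : Measurable W)
    (hWpos : ∀ᵐ ω ∂P, 0 < W ω) (hg : AEStronglyMeasurable g P) (hψ : Measurable ψ)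
    (hm : HasMellin ψ s m) (hint : Integrable (fun ω => g ω * (W ω : ℂ) ^ (-s)) P) :
    HasMellin (fun x => ∫ ω, g ω * ψ (x * W ω) ∂P) s ((∫ ω, g ω * (W ω : ℂ) ^ (-s) ∂P) * m) := by
  have hdil : ∀ w : ℝ, 0 < w → MellinConvergent (fun x => ψ (x * w)) s ∧
      mellin (fun x => ψ (x * w)) s = (w : ℂ) ^ (-s) * m := fun w hw => by
    have h := (MellinConvergent.comp_mul_left (f := ψ) (s := s) hw).2 hm.1
    refine ⟨by simpa only [mul_comm] using h, ?_⟩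
    rw [mellin_comp_mul_right _ _ hw, hm.2, smul_eq_mul]
  have hnorm : ∀ w : ℝ, 0 < w →
      ∫ x in Set.Ioi (0 : ℝ), ‖(x : ℂ) ^ (s - 1) * ψ (x * w)‖ =
        w ^ (-s.re) * ∫ x in Set.Ioi (0 : ℝ), ‖(x : ℂ) ^ (s - 1) * ψ x‖ := fun w hw => by
    have h := integral_comp_mul_right_Ioi (fun x : ℝ => ‖(x : ℂ) ^ (s - 1) * ψ x‖) 0 hw
    rw [zero_mul, smul_eq_mul] at h
    have h2 : ∀ x ∈ Set.Ioi (0 : ℝ), ‖(x : ℂ) ^ (s - 1) * ψ (x * w)‖ =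
        w ^ (1 - s.re) * ‖((x * w : ℝ) : ℂ) ^ (s - 1) * ψ (x * w)‖ := fun x hx => by
      have hx : 0 < x := hx
      rw [norm_mul, norm_mul, norm_ofReal_cpow_sub_one hx,
        norm_ofReal_cpow_sub_one (mul_pos hx hw), Real.mul_rpow hx.le hw.le]
      have : w ^ (1 - s.re) * w ^ (s.re - 1) = 1 := by
        rw [← Real.rpow_add hw]; simp
      linear_combination (-(x ^ (s.re - 1) * ‖ψ (x * w)‖)) * this
    rw [setIntegral_congr_fun measurableSet_Ioi h2, integral_const_mul, h, ← mul_assoc]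
    congr 1
    rw [← Real.rpow_neg_one, ← Real.rpow_add hw]
    congr 1; ring
  set G : Ω × ℝ → ℂ := fun p => (p.2 : ℂ) ^ (s - 1) * (g p.1 * ψ (p.2 * W p.1)) with hG
  have hGm : AEStronglyMeasurable G (P.prod (volume.restrict (Set.Ioi 0))) := by
    refine AEStronglyMeasurable.mul ?_ (AEStronglyMeasurable.mul ?_ ?_)
    · exact ((Complex.measurable_ofReal.comp measurable_snd).pow_const
        (s - 1)).aestronglyMeasurable
    · exact hg.comp_fst
    · exact (hψ.comp (measurable_snd.mul (hW.comp measurable_fst))).aestronglyMeasurable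
  -- Tonelli: the inner integral of the norm is `‖g‖ W^(-Re s)` times a constant, by scaling, and
  -- this is integrable by `hint`.
  have hGi : Integrable G (P.prod (volume.restrict (Set.Ioi 0))) := by
    rw [integrable_prod_iff hGm]
    constructor
    · filter_upwards [hWpos] with ω hω
      have := ((hdil _ hω).1).const_mul (g ω)
      refine this.congr (Filter.Eventually.of_forall fun x => ?_)
      simp only [hG, smul_eq_mul]; ring
    · refine (hint.norm.mul_const
        (∫ x in Set.Ioi (0 : ℝ), ‖(x : ℂ) ^ (s - 1) * ψ x‖)).congr ?_
      filter_upwards [hWpos] with ω hω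
      have : ∀ x : ℝ, ‖G (ω, x)‖ = ‖g ω‖ * ‖(x : ℂ) ^ (s - 1) * ψ (x * W ω)‖ := fun x => by
        simp only [hG, norm_mul]; ring
      simp only [this]
      rw [integral_const_mul, hnorm _ hω, norm_mul, norm_ofReal_cpow_neg hω]
      ring
  have hsw := integral_integral_swap (f := fun ω x => G (ω, x)) hGi
  refine ⟨?_, ?_⟩
  · refine hGi.integral_prod_right.congr (Filter.Eventually.of_forall fun x => ?_)
    simp only [hG, smul_eq_mul, integral_const_mul]
  · rw [mellin]
    simp only [hG, integral_const_mul] at hsw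
    simp only [smul_eq_mul]
    rw [← hsw, ← integral_mul_const]
    refine integral_congr_ae ?_
    filter_upwards [hWpos] with ω hω
    have : ∀ x : ℝ, (x : ℂ) ^ (s - 1) * (g ω * ψ (x * W ω)) =
        g ω * ((x : ℂ) ^ (s - 1) • ψ (x * W ω)) := fun x => by rw [smul_eq_mul]; ring
    simp only [this, integral_const_mul]
    have h3 := (hdil _ hω).2
    rw [mellin] at h3
    rw [h3]; ring

theorem hasMellin_Gamma {s : ℂ} (hs : 0 < s.re) :
    HasMellin (fun x : ℝ => ((Real.exp (-x) : ℝ) : ℂ)) s (Complex.Gamma s) := by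
  have := Complex.GammaIntegral_convergent hs
  refine ⟨?_, ?_⟩
  · refine this.congr (Filter.Eventually.of_forall fun x => ?_)
    simp [mul_comm]
  · rw [Complex.Gamma_eq_integral hs, Complex.GammaIntegral_eq_mellin]

/-- The open interval encodes the strict inequalities `x < u` in the incomplete Gamma integral and
`V < v` in the outage event; the endpoint is a null set. -/
theorem hasMellin_one_Ioo {s : ℂ} (hs : 0 < s.re) :
    HasMellin ((Set.Ioo (0 : ℝ) 1).indicator fun _ => (1 : ℂ)) s (1 / s) := by
  have h := hasMellin_one_Ioc hs
  have hae : (fun x : ℝ => (x : ℂ) ^ (s - 1) • (Set.Ioc (0 : ℝ) 1).indicator (fun _ => (1 : ℂ)) x)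
      =ᵐ[volume.restrict (Set.Ioi 0)]
      fun x : ℝ => (x : ℂ) ^ (s - 1) • (Set.Ioo (0 : ℝ) 1).indicator (fun _ => (1 : ℂ)) x := by
    refine ae_restrict_of_ae ?_
    have : ∀ᵐ x : ℝ, x ≠ 1 := by simp [ae_iff]
    filter_upwards [this] with x hx
    have : x ∈ Set.Ioc (0 : ℝ) 1 ↔ x ∈ Set.Ioo (0 : ℝ) 1 := by
      simp [lt_iff_le_and_ne, hx]
    simp [Set.indicator, lt_iff_le_and_ne, hx]
  refine ⟨h.1.congr hae, ?_⟩
  rw [mellin, ← integral_congr_ae hae, ← h.2, mellin]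

theorem hasMellin_congr {f f' : ℝ → ℂ} {s m : ℂ} (h : HasMellin f s m)
    (hf : ∀ x, 0 < x → f x = f' x) : HasMellin f' s m := by
  have hs : Set.EqOn (fun x : ℝ => (x : ℂ) ^ (s - 1) • f x)
      (fun x : ℝ => (x : ℂ) ^ (s - 1) • f' x) (Set.Ioi 0) := fun x hx => by
    simp only [hf x hx]
  refine ⟨h.1.congr_fun hs measurableSet_Ioi, ?_⟩
  rw [mellin, ← setIntegral_congr_fun measurableSet_Ioi hs, ← h.2, mellin]

theorem hasMellin_comp_rpow {f : ℝ → ℂ} {s m : ℂ} {a : ℝ} (ha : a ≠ 0)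
    (h : HasMellin f (s / a) m) : HasMellin (fun x => f (x ^ a)) s (((|a|⁻¹ : ℝ) : ℂ) * m) :=
  ⟨(MellinConvergent.comp_rpow ha).2 h.1, by
    rw [mellin_comp_rpow, h.2, Complex.real_smul]⟩

theorem hasMellin_comp_mul_left {f : ℝ → ℂ} {s m : ℂ} {a : ℝ} (ha : 0 < a)
    (h : HasMellin f s m) : HasMellin (fun x => f (a * x)) s ((a : ℂ) ^ (-s) * m) :=
  ⟨(MellinConvergent.comp_mul_left ha).2 h.1, by
    rw [mellin_comp_mul_left _ _ ha, h.2, smul_eq_mul]⟩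

theorem hasMellin_cpow_mul {f : ℝ → ℂ} {s a m : ℂ}
    (h : HasMellin f (s + a) m) : HasMellin (fun x => (x : ℂ) ^ a * f x) s m :=
  ⟨MellinConvergent.cpow_smul.2 h.1, by
    simpa only [smul_eq_mul] using (mellin_cpow_smul f s a).trans h.2⟩

theorem hasMellin_const_mul {f : ℝ → ℂ} {s m : ℂ} (c : ℂ)
    (h : HasMellin f s m) : HasMellin (fun x => c * f x) s (c * m) := by
  have := hasMellin_const_smul h.1 c
  rw [h.2] at this
  simpa only [smul_eq_mul] using this

/-- `Γ(a, x)` is the average of the dilates `1_(0,1)(x/u)` with weight `u^(a-1) e^(-u)`. The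
indicator contributes `1/w` and the weight contributes `Γ(a + w)`; `a` itself may be negative. -/
theorem hasMellin_upperIncompleteGamma {a : ℝ} {w : ℂ} (hw : 0 < w.re) (haw : 0 < a + w.re) :
    HasMellin (fun x => (upperIncompleteGamma a x : ℂ)) w (Complex.Gamma (a + w) / w) := by
  have hG := hasMellin_Gamma (s := a + w) (by simpa using haw)
  have heq : ∀ u ∈ Set.Ioi (0 : ℝ), ((u ^ (a - 1) * Real.exp (-u) : ℝ) : ℂ) * ((u⁻¹ : ℝ) : ℂ) ^ (-w)
      = (u : ℂ) ^ ((a + w) - 1) • ((Real.exp (-u) : ℝ) : ℂ) := fun u hu => by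
    have hu : 0 < u := hu
    have hu0 : (u : ℂ) ≠ 0 := by exact_mod_cast hu.ne'
    rw [Complex.ofReal_inv, Complex.inv_cpow, Complex.cpow_neg, inv_inv, smul_eq_mul,
      Complex.ofReal_mul, Complex.ofReal_cpow hu.le, mul_right_comm, ← Complex.cpow_add _ _ hu0]
    · congr 2; push_cast; ring
    · rw [Complex.arg_ofReal_of_nonneg hu.le]; exact Real.pi_pos.ne
  have key := hasMellin_integral_comp_mul (P := volume.restrict (Set.Ioi (0 : ℝ)))
    (g := fun u => ((u ^ (a - 1) * Real.exp (-u) : ℝ) : ℂ)) (W := fun u => u⁻¹) (s := w)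
    measurable_inv
    (by filter_upwards [ae_restrict_mem measurableSet_Ioi] with u hu using inv_pos.2 hu)
    (by fun_prop)
    (measurable_const.indicator measurableSet_Ioo) (hasMellin_one_Ioo hw)
    (hG.1.congr_fun (fun u hu => (heq u hu).symm) measurableSet_Ioi)
  rw [setIntegral_congr_fun measurableSet_Ioi heq] at key
  have hG2 := hG.2
  rw [mellin] at hG2
  rw [hG2, mul_one_div] at key
  refine hasMellin_congr key fun x hx => ?_
  rw [upperIncompleteGamma, ← integral_complex_ofReal,
    ← integral_indicator measurableSet_Ioi, ← integral_indicator measurableSet_Ioi]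
  congr 1; ext u
  by_cases hu : 0 < u
  · by_cases hxu : x < u
    · have h1 : x * u⁻¹ < 1 := by rw [← div_eq_mul_inv, div_lt_one hu]; exact hxu
      have h2 : 0 < x * u⁻¹ := by positivity
      simp [Set.indicator, hu, hxu, h1, h2]
    · have h1 : ¬ x * u⁻¹ < 1 := by rw [← div_eq_mul_inv, div_lt_one hu]; exact hxu
      simp [Set.indicator, hxu, h1]
  · have : ¬ x < u := fun h => hu (hx.trans h)
    simp [Set.indicator, hu, this]

/-- The Mellin transform of `(1 + x) ^ (-t)` is the Beta function. -/
theorem hasMellin_one_add_cpow {s t : ℂ} (hs : 0 < s.re) (hst : s.re < t.re) :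
    HasMellin (fun x : ℝ => ((1 + x : ℝ) : ℂ) ^ (-t)) s
      (Complex.Gamma s * Complex.Gamma (t - s) / Complex.Gamma t) := by
  have ht : 0 < t.re := hs.trans hst
  have hts : 0 < (t - s).re := by simpa using hst
  have hG := hasMellin_Gamma hts
  have heq : ∀ u ∈ Set.Ioi (0 : ℝ), ((u : ℂ) ^ (t - 1) * ((Real.exp (-u) : ℝ) : ℂ)) * (u : ℂ) ^ (-s)
      = (u : ℂ) ^ ((t - s) - 1) • ((Real.exp (-u) : ℝ) : ℂ) := fun u hu => by
    have hu : 0 < u := hu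
    have hu0 : (u : ℂ) ≠ 0 := by exact_mod_cast hu.ne'
    rw [smul_eq_mul, mul_right_comm, ← Complex.cpow_add _ _ hu0]
    congr 2; ring
  -- `Γ(t) (1 + x)^(-t) = ∫ u^(t-1) e^(-u) e^(-xu) du` is an average of dilates of `e^(-x)`.
  have key := hasMellin_integral_comp_mul (P := volume.restrict (Set.Ioi (0 : ℝ)))
    (g := fun u => (u : ℂ) ^ (t - 1) * ((Real.exp (-u) : ℝ) : ℂ)) (W := fun u => u) (s := s)
    measurable_id
    (by filter_upwards [ae_restrict_mem measurableSet_Ioi] with u hu using hu)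
    (by fun_prop)
    (by fun_prop) (hasMellin_Gamma hs)
    (hG.1.congr_fun (fun u hu => (heq u hu).symm) measurableSet_Ioi)
  rw [setIntegral_congr_fun measurableSet_Ioi heq] at key
  have hG2 := hG.2
  rw [mellin] at hG2
  rw [hG2] at key
  have h2 := hasMellin_const_mul (Complex.Gamma t)⁻¹ key
  have e : (Complex.Gamma t)⁻¹ * (Complex.Gamma (t - s) * Complex.Gamma s) =
    Complex.Gamma s * Complex.Gamma (t - s) / Complex.Gamma t := by ring
  rw [e] at h2
  refine hasMellin_congr h2 fun x hx => ?_
  have h3 := Complex.integral_cpow_mul_exp_neg_mul_Ioi ht (r := 1 + x) (by positivity)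
  have h4 : ∀ u : ℝ, (u : ℂ) ^ (t - 1) * ((Real.exp (-u) : ℝ) : ℂ) *
      ((Real.exp (-(x * u)) : ℝ) : ℂ) = (u : ℂ) ^ (t - 1) * Complex.exp (-(((1 + x : ℝ) : ℂ) * u)) :=
    fun u => by
    rw [mul_assoc, ← Complex.ofReal_mul, ← Real.exp_add]
    push_cast
    congr 2; ring
  simp only [h4, h3]
  have h5 : Complex.Gamma t ≠ 0 := Complex.Gamma_ne_zero_of_re_pos ht
  rw [mul_comm, mul_assoc, mul_inv_cancel₀ h5, mul_one, one_div, Complex.inv_cpow,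
    Complex.cpow_neg]
  rw [Complex.arg_ofReal_of_nonneg (by positivity)]; exact Real.pi_pos.ne

/-! ### Bounds for the Gamma function on vertical lines -/

theorem ofReal_rpow_cpow {x : ℝ} (hx : 0 < x) (a : ℝ) (s : ℂ) :
    ((x ^ a : ℝ) : ℂ) ^ s = (x : ℂ) ^ (a * s) := by
  have hx0 : (x : ℂ) ≠ 0 := by exact_mod_cast hx.ne'
  have hxa : ((x ^ a : ℝ) : ℂ) ≠ 0 := by exact_mod_cast (Real.rpow_pos_of_pos hx a).ne'
  rw [Complex.cpow_def_of_ne_zero hx0, Complex.cpow_def_of_ne_zero hxa,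
    ← Complex.ofReal_log (Real.rpow_pos_of_pos hx a).le, Real.log_rpow hx,
    ← Complex.ofReal_log hx.le]
  congr 1; push_cast; ring

theorem Complex.norm_Gamma_le_Gamma_re {z : ℂ} (hz : 0 < z.re) :
    ‖Complex.Gamma z‖ ≤ Real.Gamma z.re := by
  rw [Complex.Gamma_eq_integral hz, Complex.GammaIntegral, Real.Gamma_eq_integral hz]
  refine (norm_integral_le_integral_norm _).trans (le_of_eq ?_)
  refine setIntegral_congr_fun measurableSet_Ioi fun x hx => ?_
  rw [norm_mul, norm_ofReal_cpow_sub_one hx, Complex.norm_real, Real.norm_eq_abs,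
    abs_of_pos (Real.exp_pos _)]

/-- From `Γ(z + 2) = (z + 1) z Γ(z)`, `|Γ(z + 2)| ≤ Γ(a + 2)` and `|z + 1| ≥ |z|` one gets `|z|²
|Γ(z)| ≤ Γ(a + 2)`. Quadratic decay suffices for integrability, so Stirling's formula is not needed.
-/
theorem norm_Gamma_vertical_le {a : ℝ} (ha : 0 < a) (y : ℝ) :
    ‖Complex.Gamma (a + y * Complex.I)‖ ≤ Real.Gamma (a + 2) * (a ^ 2)⁻¹ * (1 + (a⁻¹ * y) ^ 2)⁻¹ := by
  set z : ℂ := a + y * Complex.I with hz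
  have hre : z.re = a := by simp [hz]
  have him : z.im = y := by simp [hz]
  have hz0 : z ≠ 0 := fun h => by rw [h] at hre; simp at hre; exact ha.ne hre
  have hz1 : z + 1 ≠ 0 := fun h => by
    have : (z + 1).re = 0 := by rw [h]; simp
    simp [hre] at this; linarith
  have h2 : Complex.Gamma (z + 1 + 1) = (z + 1) * (z * Complex.Gamma z) := by
    rw [Complex.Gamma_add_one _ hz1, Complex.Gamma_add_one _ hz0]
  have h3 : ‖Complex.Gamma (z + 1 + 1)‖ ≤ Real.Gamma (a + 2) := by
    have := Complex.norm_Gamma_le_Gamma_re (z := z + 1 + 1) (by simp [hre]; linarith)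
    have e : (z + 1 + 1).re = a + 2 := by simp [hre]; ring
    rwa [e] at this
  have hn : ‖z‖ ^ 2 = a ^ 2 * (1 + (a⁻¹ * y) ^ 2) := by
    rw [← Complex.normSq_eq_norm_sq, Complex.normSq_apply, hre, him]; field_simp
  have hn1 : ‖z‖ ≤ ‖z + 1‖ := by
    rw [← sq_le_sq₀ (norm_nonneg _) (norm_nonneg _), ← Complex.normSq_eq_norm_sq,
      ← Complex.normSq_eq_norm_sq, Complex.normSq_apply, Complex.normSq_apply]
    simp [hre]; nlinarith
  have hzp : 0 < ‖z‖ := norm_pos_iff.2 hz0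
  rw [h2, norm_mul, norm_mul] at h3
  have h4 : ‖z‖ ^ 2 * ‖Complex.Gamma z‖ ≤ Real.Gamma (a + 2) := by
    refine le_trans ?_ h3
    rw [sq, mul_assoc]; gcongr
  rw [mul_assoc, ← mul_inv, ← hn, ← div_eq_mul_inv, le_div_iff₀ (by positivity), mul_comm]
  exact h4

theorem integrable_Gamma_vertical {a b : ℝ} (ha : 0 < a) (hb : b ≠ 0) :
    Integrable fun y : ℝ => Complex.Gamma (a + ((b * y : ℝ) : ℂ) * Complex.I) := by
  have hc : Continuous fun y : ℝ => Complex.Gamma (a + ((b * y : ℝ) : ℂ) * Complex.I) := by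
    rw [continuous_iff_continuousAt]
    intro y
    refine ContinuousAt.comp (g := Complex.Gamma) ?_ (by fun_prop)
    refine (Complex.differentiableAt_Gamma _ fun m h => ?_).continuousAt
    have := congrArg Complex.re h
    simp at this
    have : (0 : ℝ) ≤ m := Nat.cast_nonneg m
    linarith
  refine ((integrable_inv_one_add_sq.comp_mul_left' (R := a⁻¹ * b)
    (mul_ne_zero (inv_ne_zero ha.ne') hb)).const_mul (Real.Gamma (a + 2) * (a ^ 2)⁻¹)).mono'
    hc.aestronglyMeasurable (Filter.Eventually.of_forall fun y => ?_)
  simpa only [mul_assoc] using norm_Gamma_vertical_le ha (b * y)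

/-! ### Moments of the fading density -/

section Fading

variable {α μ φ S₀ hf : ℝ}

/-- The scale `(μ / (ĥ_f^α S₀^α))^(-1/α)` of the fading density. -/
noncomputable def fadingScale (α μ S₀ hf : ℝ) : ℝ := (μ / (hf ^ α * S₀ ^ α)) ^ (-1 / α)

theorem fadingScale_pos (hμ : 0 < μ) (hS₀ : 0 < S₀) (hhf : 0 < hf) :
    0 < fadingScale α μ S₀ hf := by
  unfold fadingScale; positivity

theorem upperIncompleteGamma_nonneg (a : ℝ) {x : ℝ} (hx : 0 ≤ x) :
    0 ≤ upperIncompleteGamma a x :=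
  setIntegral_nonneg measurableSet_Ioi fun _ hu =>
    mul_nonneg (Real.rpow_nonneg (hx.trans (le_of_lt hu)) _) (Real.exp_pos _).le

theorem fadingPDF_nonneg (hμ : 0 < μ) (hφ : 0 < φ) (hS₀ : 0 < S₀) (hhf : 0 < hf) (x : ℝ) :
    0 ≤ fadingPDF α μ φ S₀ hf x := by
  unfold fadingPDF
  split_ifs with hx
  · have := upperIncompleteGamma_nonneg ((α * μ - φ) / α)
      (x := μ * x ^ α / (S₀ ^ α * hf ^ α)) (by positivity)
    have := Real.Gamma_pos_of_pos hμ
    positivity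
  · exact le_rfl

/-- Moments of the fading density. -/
theorem hasMellin_fadingPDF (hα : 0 < α) (hμ : 0 < μ) (hφ : 0 < φ) (hS₀ : 0 < S₀) (hhf : 0 < hf)
    {s : ℂ} (hsφ : s.re < φ) (hsμ : s.re < α * μ) :
    HasMellin (fun x => (fadingPDF α μ φ S₀ hf x : ℂ)) (1 - s)
      (φ / Real.Gamma μ * (Complex.Gamma (μ - s / α) / (φ - s)) *
        (fadingScale α μ S₀ hf : ℂ) ^ (-s)) := by
  set b : ℝ := μ / (hf ^ α * S₀ ^ α) with hb
  have hb0 : 0 < b := by positivity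
  have hα0 : (α : ℂ) ≠ 0 := by exact_mod_cast hα.ne'
  have hre : ((φ - s) / α : ℂ).re = (φ - s.re) / α := by
    rw [Complex.div_ofReal_re]; simp
  -- The density is a constant times `x^(φ-1) Γ((αμ-φ)/α, b x^α)`. The power shifts `1 - s` to `φ -
  -- s`, and the substitution `x ↦ x^α` divides it by `α`.
  have h1 : HasMellin (fun x => (upperIncompleteGamma ((α * μ - φ) / α) x : ℂ)) ((φ - s) / α) _ :=
    hasMellin_upperIncompleteGamma (by rw [hre]; exact div_pos (by linarith) hα)
      (by rw [hre, ← add_div]; exact div_pos (by linarith) hα)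
  have h2 := hasMellin_comp_rpow hα.ne' (hasMellin_comp_mul_left hb0 h1)
  have h3 := hasMellin_const_mul
    ((φ * μ ^ (φ / α) / (S₀ ^ φ * hf ^ φ * Real.Gamma μ) : ℝ) : ℂ)
    (hasMellin_cpow_mul (s := 1 - s) (a := φ - 1) (by convert h2 using 1; ring))
  have h4 := hasMellin_congr (f' := fun x => (fadingPDF α μ φ S₀ hf x : ℂ)) h3 fun x hx => by
    have e : b * x ^ α = μ * x ^ α / (S₀ ^ α * hf ^ α) := by rw [hb]; ring
    rw [fadingPDF, if_pos hx, e]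
    push_cast
    rw [Complex.ofReal_cpow hx.le]
    push_cast
    ring
  convert h4 using 1
  have hφs : (φ - s : ℂ) ≠ 0 := fun h => by
    have := congrArg Complex.re h
    simp at this; linarith
  have hΓ : (Real.Gamma μ : ℂ) ≠ 0 := by exact_mod_cast (Real.Gamma_pos_of_pos hμ).ne'
  have hbφ : b ^ (-(φ / α)) = (S₀ ^ φ * hf ^ φ) / μ ^ (φ / α) := by
    rw [hb, Real.div_rpow hμ.le (by positivity), Real.mul_rpow (by positivity) (by positivity),
      ← Real.rpow_mul hhf.le, ← Real.rpow_mul hS₀.le, Real.rpow_neg hμ.le,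
      show α * -(φ / α) = -φ by field_simp, Real.rpow_neg hhf.le, Real.rpow_neg hS₀.le]
    field_simp
  have hb0' : (b : ℂ) ≠ 0 := by exact_mod_cast hb0.ne'
  have hsc : (fadingScale α μ S₀ hf : ℂ) ^ (-s) = (b : ℂ) ^ (s / α) := by
    rw [fadingScale, ← hb, ofReal_rpow_cpow hb0]
    congr 1; push_cast; field_simp
  have hsplit : (b : ℂ) ^ (-((φ - s) / α)) = ((b ^ (-(φ / α)) : ℝ) : ℂ) * (b : ℂ) ^ (s / α) := by
    rw [Complex.ofReal_cpow hb0.le, ← Complex.cpow_add _ _ hb0']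
    congr 1; push_cast; ring
  have hΓarg : (((α * μ - φ) / α : ℝ) : ℂ) + (φ - s) / α = μ - s / α := by
    push_cast; field_simp; ring
  rw [hsplit, hΓarg, hsc, hbφ, abs_of_pos hα]
  have hμ' : ((μ ^ (φ / α) : ℝ) : ℂ) ≠ 0 := by exact_mod_cast (Real.rpow_pos_of_pos hμ _).ne'
  have hS' : ((S₀ ^ φ : ℝ) : ℂ) ≠ 0 := by exact_mod_cast (Real.rpow_pos_of_pos hS₀ _).ne'
  have hh' : ((hf ^ φ : ℝ) : ℂ) ≠ 0 := by exact_mod_cast (Real.rpow_pos_of_pos hhf _).ne'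
  simp only [Complex.ofReal_div, Complex.ofReal_mul, Complex.ofReal_inv]
  field_simp

theorem integrableOn_fadingPDF (hα : 0 < α) (hμ : 0 < μ) (hφ : 0 < φ) (hS₀ : 0 < S₀)
    (hhf : 0 < hf) : IntegrableOn (fadingPDF α μ φ S₀ hf) (Set.Ioi 0) := by
  have h := (hasMellin_fadingPDF hα hμ hφ hS₀ hhf (s := 0) (by simpa using hφ)
    (by simpa using mul_pos hα hμ)).1
  have h2 : IntegrableOn (fun x => (fadingPDF α μ φ S₀ hf x : ℂ)) (Set.Ioi 0) := by
    refine h.congr (Filter.Eventually.of_forall fun x => ?_)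
    simp
  exact h2.re

end Fading

/-! ### The Fox function by Mellin inversion -/

theorem ofReal_one_add_cpow_norm_le_one {x : ℝ} (hx : 0 ≤ x) {t : ℂ} (ht : 0 ≤ t.re) :
    ‖((1 + x : ℝ) : ℂ) ^ (-t)‖ ≤ 1 := by
  rw [norm_ofReal_cpow_neg (by positivity)]
  exact Real.rpow_le_one_of_one_le_of_nonpos (by linarith) (by linarith)

theorem continuous_ofReal_one_add_sq_cpow (c : ℝ) (t : ℂ) :
    Continuous fun x : ℝ => ((1 + (x * c) ^ 2 : ℝ) : ℂ) ^ (-t) := by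
  rw [continuous_iff_continuousAt]
  intro x
  have : ContinuousAt (fun x : ℝ => ((1 + (x * c) ^ 2 : ℝ) : ℂ)) x := by fun_prop
  refine this.cpow continuousAt_const (Or.inl ?_)
  rw [Complex.ofReal_re]; positivity

theorem verticalLineIntegral_eq_smul {c : ℝ} {F : ℂ → ℂ} :
    verticalLineIntegral c F = (1 / (2 * Real.pi) : ℝ) • ∫ y : ℝ, F (c + y * Complex.I) := by
  rw [verticalLineIntegral, integral_mul_const, Complex.real_smul]
  push_cast
  field_simp

section Fading

variable {α μ φ S₀ hf : ℝ}

/-- `E[(1 + κ X²) ^ (-t)]` for `X` distributed according to the fading density. -/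
noncomputable def fadingLaplace (α μ φ S₀ hf κ : ℝ) (t : ℂ) : ℂ :=
  ∫ y in Set.Ioi (0 : ℝ), (fadingPDF α μ φ S₀ hf y : ℂ) * ((1 + κ * y ^ 2 : ℝ) : ℂ) ^ (-t)

theorem fadingPDF_moment (hα : 0 < α) (hμ : 0 < μ) (hφ : 0 < φ) (hS₀ : 0 < S₀) (hhf : 0 < hf)
    {s : ℂ} (hsφ : s.re < φ) (hsμ : s.re < α * μ) :
    IntegrableOn (fun x : ℝ => (fadingPDF α μ φ S₀ hf x : ℂ) * (x : ℂ) ^ (-s)) (Set.Ioi 0) ∧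
      ∫ x in Set.Ioi (0 : ℝ), (fadingPDF α μ φ S₀ hf x : ℂ) * (x : ℂ) ^ (-s) =
        φ / Real.Gamma μ * (Complex.Gamma (μ - s / α) / (φ - s)) *
          (fadingScale α μ S₀ hf : ℂ) ^ (-s) := by
  have h := hasMellin_fadingPDF hα hμ hφ hS₀ hhf hsφ hsμ
  have e : ∀ x : ℝ, (fadingPDF α μ φ S₀ hf x : ℂ) * (x : ℂ) ^ (-s) =
      (x : ℂ) ^ ((1 - s) - 1) • (fadingPDF α μ φ S₀ hf x : ℂ) := fun x => by
    rw [smul_eq_mul, mul_comm]; congr 2; ring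
  simp only [e]
  exact h

theorem hasMellin_one_add_sq_cpow {s t : ℂ} (hs : 0 < s.re) (hst : s.re < 2 * t.re) :
    HasMellin (fun x : ℝ => ((1 + x ^ 2 : ℝ) : ℂ) ^ (-t)) s
      (1 / 2 * (Complex.Gamma (s / 2) * Complex.Gamma (t - s / 2) / Complex.Gamma t)) := by
  have hre : (s / ((2 : ℝ) : ℂ)).re = s.re / 2 := Complex.div_ofReal_re _ _
  have h := hasMellin_comp_rpow (s := s) two_ne_zero (hasMellin_one_add_cpow
    (s := s / (2 : ℝ)) (t := t) (by rw [hre]; linarith) (by rw [hre]; linarith))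
  simpa using h

theorem hasMellin_fadingPDF_average (hα : 0 < α) (hμ : 0 < μ) (hφ : 0 < φ) (hS₀ : 0 < S₀)
    (hhf : 0 < hf) {s t : ℂ} (hs : 0 < s.re) (hst : s.re < 2 * t.re) (hsφ : s.re < φ)
    (hsμ : s.re < α * μ) :
    HasMellin (fun x : ℝ => ∫ y in Set.Ioi (0 : ℝ), (fadingPDF α μ φ S₀ hf y : ℂ) *
        ((1 + (x * y) ^ 2 : ℝ) : ℂ) ^ (-t)) s
      (φ / Real.Gamma μ * (Complex.Gamma (μ - s / α) / (φ - s)) *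
          (fadingScale α μ S₀ hf : ℂ) ^ (-s) *
        (1 / 2 * (Complex.Gamma (s / 2) * Complex.Gamma (t - s / 2) / Complex.Gamma t))) := by
  have hm := fadingPDF_moment hα hμ hφ hS₀ hhf hsφ hsμ
  have key := hasMellin_integral_comp_mul (P := volume.restrict (Set.Ioi (0 : ℝ)))
    (g := fun y => (fadingPDF α μ φ S₀ hf y : ℂ)) (W := fun y => y) measurable_id
    (by filter_upwards [ae_restrict_mem measurableSet_Ioi] with u hu using hu)
    ((integrableOn_fadingPDF hα hμ hφ hS₀ hhf).ofReal.aestronglyMeasurable)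
    (by simpa using (continuous_ofReal_one_add_sq_cpow 1 t).measurable)
    (hasMellin_one_add_sq_cpow hs hst) hm.1
  rwa [hm.2] at key

/-- Mellin inversion recovers a function only at its points of continuity; here dominated
convergence applies with the density as majorant. -/
theorem continuous_fadingPDF_average (hα : 0 < α) (hμ : 0 < μ) (hφ : 0 < φ) (hS₀ : 0 < S₀)
    (hhf : 0 < hf) {t : ℂ} (ht : 0 ≤ t.re) :
    Continuous (fun x : ℝ => ∫ y in Set.Ioi (0 : ℝ), (fadingPDF α μ φ S₀ hf y : ℂ) *
        ((1 + (x * y) ^ 2 : ℝ) : ℂ) ^ (-t)) := by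
  have hi := (integrableOn_fadingPDF (α := α) hα hμ hφ hS₀ hhf).ofReal (𝕜 := ℂ)
  refine continuous_of_dominated (fun x => ?_) (fun x => ?_) hi.norm ?_
  · refine hi.aestronglyMeasurable.mul ?_
    simpa only [mul_comm] using (continuous_ofReal_one_add_sq_cpow x t).aestronglyMeasurable
  · refine Filter.Eventually.of_forall fun y => ?_
    rw [norm_mul]
    exact mul_le_of_le_one_right (norm_nonneg _) (ofReal_one_add_cpow_norm_le_one (sq_nonneg _) ht)
  · exact Filter.Eventually.of_forall fun y =>
      continuous_const.mul (continuous_ofReal_one_add_sq_cpow y t)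

/-- The parameters `(1 - φ, 1)` and `(-φ, 1)` contribute `Γ(φ - s)/Γ(1 + φ - s) = 1/(φ - s)`. -/
theorem foxHKernel_fading {s t : ℂ} (hs : s.re < φ) :
    foxHKernel 1 3 (upperParams α μ φ t) (lowerParams φ) s =
      Complex.Gamma (s / 2) * Complex.Gamma (t - s / 2) *
        (Complex.Gamma (μ - s / α) / (φ - s)) := by
  have hφs : (φ - s : ℂ) ≠ 0 := fun h => by
    have := congrArg Complex.re h
    simp at this; linarith
  have hΓ : Complex.Gamma (φ - s) ≠ 0 :=
    Complex.Gamma_ne_zero_of_re_pos (by simpa using hs)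
  have h1 : Complex.Gamma (1 + (φ : ℂ) - s) = (φ - s) * Complex.Gamma (φ - s) := by
    rw [← Complex.Gamma_add_one _ hφs]; congr 1; ring
  have e1 : (2 : ℂ)⁻¹ * s = s / 2 := by ring
  simp [foxHKernel, upperParams, lowerParams, Finset.prod_filter, Fin.prod_univ_succ, e1, h1]
  field_simp

/-- In each family the pole nearest to the line is the one with `ν = 0`. -/
theorem foxHSeparates_fading (hα : 0 < α) {t : ℂ} {γ : ℝ} :
    FoxHSeparates 1 3 (upperParams α μ φ t) (lowerParams φ) γ ↔
      0 < γ ∧ γ < 2 * t.re ∧ γ < φ ∧ γ < α * μ := by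
  have hre : ∀ (z : ℂ) (r : ℝ), (z / (r : ℂ)).re = z.re / r := Complex.div_ofReal_re
  have h2 : ∀ z : ℂ, (z / (2 : ℂ)⁻¹).re = 2 * z.re := fun z => by
    rw [div_inv_eq_mul]; simp; ring
  have hα' : ∀ z : ℂ, (z / (α : ℂ)⁻¹).re = α * z.re := fun z => by
    rw [div_inv_eq_mul]; simp; ring
  simp only [FoxHSeparates, upperParams, lowerParams, Fin.forall_fin_succ]
  simp [h2, hα', -div_inv_eq_mul]
  constructor
  · rintro ⟨h1, h2, h3, h4⟩
    have h1 := h1 0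
    have h2 := h2 0
    have h3 := h3 0
    have h4 := h4 0
    simp at h1 h2 h3 h4
    exact ⟨h1, h2, h4, h3⟩
  · rintro ⟨h1, h2, h4, h3⟩
    refine ⟨fun ν => ?_, fun ν => ?_, fun ν => ?_, fun ν => ?_⟩
    · have : (0 : ℝ) ≤ ν := Nat.cast_nonneg ν
      nlinarith
    · have : (0 : ℝ) ≤ ν := Nat.cast_nonneg ν
      nlinarith
    · have : (0 : ℝ) ≤ ν := Nat.cast_nonneg ν
      nlinarith
    · have : (0 : ℝ) ≤ ν := Nat.cast_nonneg ν
      nlinarith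

/-- `Γ(μ - s/α)` is integrable along the line and all other factors are bounded there, since `|Γ(z)|
≤ Γ(Re z)` and `|φ - s| ≥ φ - γ`. -/
theorem integrable_foxHKernel_fading (hα : 0 < α) {t : ℂ} {γ : ℝ} (h0 : 0 < γ)
    (ht : γ < 2 * t.re) (hγφ : γ < φ) (hγμ : γ < α * μ) {z : ℝ} (hz : 0 < z) :
    IntegrableOnVerticalLine γ
      (fun s => foxHKernel 1 3 (upperParams α μ φ t) (lowerParams φ) s * (z : ℂ) ^ (-s)) := by
  unfold IntegrableOnVerticalLine
  have hre : ∀ y : ℝ, ((γ : ℂ) + y * Complex.I).re = γ := fun y => by simp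
  have hg := integrable_Gamma_vertical (a := μ - γ / α) (b := -α⁻¹)
    (by rw [sub_pos, div_lt_iff₀ hα]; linarith) (neg_ne_zero.2 (inv_ne_zero hα.ne'))
  have harg : ∀ y : ℝ, (((μ - γ / α : ℝ) : ℂ) + ((-α⁻¹ * y : ℝ) : ℂ) * Complex.I) =
      μ - (γ + y * Complex.I) / α := fun y => by push_cast; ring
  simp only [harg] at hg
  have hGc : ∀ w : ℝ → ℂ, Continuous w → (∀ y, 0 < (w y).re) →
      Continuous fun y => Complex.Gamma (w y) := fun w hw hpos => by
    rw [continuous_iff_continuousAt]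
    intro y
    refine ContinuousAt.comp (g := Complex.Gamma) ?_ hw.continuousAt
    refine (Complex.differentiableAt_Gamma _ fun m h => ?_).continuousAt
    have h3 := congrArg Complex.re h
    simp at h3
    have : (0 : ℝ) ≤ m := Nat.cast_nonneg m
    have := hpos y
    linarith
  have hz0 : (z : ℂ) ≠ 0 := by exact_mod_cast hz.ne'
  have hre2 : ∀ z : ℂ, (z / 2).re = z.re / 2 := fun z => by
    simp
  have h1 : ∀ y : ℝ, 0 < (((γ : ℂ) + y * Complex.I) / 2).re := fun y => by
    rw [hre2, hre]; linarith
  have h2 : ∀ y : ℝ, 0 < (t - ((γ : ℂ) + y * Complex.I) / 2).re := fun y => by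
    rw [Complex.sub_re, hre2, hre]; linarith
  have h3 : ∀ y : ℝ, (φ - ((γ : ℂ) + y * Complex.I)) ≠ 0 := fun y h => by
    have := congrArg Complex.re h
    simp at this; linarith
  have hk : ∀ y : ℝ, foxHKernel 1 3 (upperParams α μ φ t) (lowerParams φ) (γ + y * Complex.I) *
      (z : ℂ) ^ (-((γ : ℂ) + y * Complex.I)) =
      (Complex.Gamma (((γ : ℂ) + y * Complex.I) / 2) *
        Complex.Gamma (t - ((γ : ℂ) + y * Complex.I) / 2) / (φ - ((γ : ℂ) + y * Complex.I)) *
        (z : ℂ) ^ (-((γ : ℂ) + y * Complex.I))) *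
        Complex.Gamma (μ - (γ + y * Complex.I) / α) := fun y => by
    rw [foxHKernel_fading (by rw [hre]; exact hγφ)]; ring
  simp only [hk]
  refine hg.bdd_mul (c := Real.Gamma (γ / 2) * Real.Gamma (t.re - γ / 2) / (φ - γ) * z ^ (-γ)) ?_
    (Filter.Eventually.of_forall fun y => ?_)
  · refine Continuous.aestronglyMeasurable ?_
    refine Continuous.mul (Continuous.div ((hGc _ (by fun_prop) h1).mul (hGc _ (by fun_prop) h2))
      (by fun_prop) h3) ?_
    exact Continuous.const_cpow (by fun_prop) (Or.inl hz0)
  · rw [norm_mul, norm_div, norm_mul, norm_ofReal_cpow_neg hz, hre]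
    have g1 := Complex.norm_Gamma_le_Gamma_re (h1 y)
    have g2 := Complex.norm_Gamma_le_Gamma_re (h2 y)
    rw [hre2, hre] at g1
    rw [Complex.sub_re, hre2, hre] at g2
    have g3 : φ - γ ≤ ‖(φ - ((γ : ℂ) + y * Complex.I))‖ := by
      have := Complex.re_le_norm (φ - ((γ : ℂ) + y * Complex.I))
      rwa [Complex.sub_re, hre, Complex.ofReal_re] at this
    have : 0 < φ - γ := by linarith
    have : 0 < Real.Gamma (γ / 2) := Real.Gamma_pos_of_pos (by linarith)
    have : 0 < Real.Gamma (t.re - γ / 2) := Real.Gamma_pos_of_pos (by linarith)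
    gcongr

theorem verticalLineIntegral_foxHKernel_fading (hα : 0 < α) (hμ : 0 < μ) (hφ : 0 < φ)
    (hS₀ : 0 < S₀) (hhf : 0 < hf) {t : ℂ} {γ : ℝ} (h0 : 0 < γ)
    (ht : γ < 2 * t.re) (hγφ : γ < φ) (hγμ : γ < α * μ) {x : ℝ} (hx : 0 < x) :
    verticalLineIntegral γ (fun s => foxHKernel 1 3 (upperParams α μ φ t) (lowerParams φ) s *
        ((x * fadingScale α μ S₀ hf : ℝ) : ℂ) ^ (-s)) =
      2 * Real.Gamma μ / φ * Complex.Gamma t * fadingLaplace α μ φ S₀ hf (x ^ 2) t := by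
  have ht0 : 0 < t.re := by linarith
  have hν := fadingScale_pos (α := α) hμ hS₀ hhf
  have hre : ∀ y : ℝ, ((γ : ℂ) + y * Complex.I).re = γ := fun y => by simp
  have hM : ∀ y : ℝ, _ := fun y => hasMellin_fadingPDF_average (s := γ + y * Complex.I) (t := t)
    hα hμ hφ hS₀ hhf (by rwa [hre]) (by rwa [hre]) (by rwa [hre]) (by rwa [hre])
  have hΓt : Complex.Gamma t ≠ 0 := Complex.Gamma_ne_zero_of_re_pos ht0
  have hΓμ : (Real.Gamma μ : ℂ) ≠ 0 := by exact_mod_cast (Real.Gamma_pos_of_pos hμ).ne'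
  have hφ0 : (φ : ℂ) ≠ 0 := by exact_mod_cast hφ.ne'
  have hker : ∀ (z : ℝ) (y : ℝ), foxHKernel 1 3 (upperParams α μ φ t) (lowerParams φ)
      (γ + y * Complex.I) * (z : ℂ) ^ (-((γ : ℂ) + y * Complex.I)) = _ := fun z y => by
    rw [foxHKernel_fading (by rwa [hre])]
  have hval : ∀ y : ℝ, mellin (fun x : ℝ => ∫ y in Set.Ioi (0 : ℝ), (fadingPDF α μ φ S₀ hf y : ℂ) *
        ((1 + (x * y) ^ 2 : ℝ) : ℂ) ^ (-t)) (γ + y * Complex.I) =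
      φ / (2 * Real.Gamma μ * Complex.Gamma t) *
        (foxHKernel 1 3 (upperParams α μ φ t) (lowerParams φ) (γ + y * Complex.I) *
          (fadingScale α μ S₀ hf : ℂ) ^ (-((γ : ℂ) + y * Complex.I))) := fun y => by
    rw [(hM y).2, hker]; field_simp
  -- The Mellin transform of the average is the kernel at the bare fading scale, up to a factor
  -- independent of `s`; inversion at `x` supplies `x^(-s)`, which merges with the scale into the
  -- argument of the Fox function.
  have hinv := mellinInv_mellin_eq γ _ hx (by simpa using (hM 0).1)
    (by
      rw [Complex.VerticalIntegrable]
      simp only [hval]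
      exact (integrable_foxHKernel_fading hα h0 ht hγφ hγμ hν).const_mul _)
    (continuous_fadingPDF_average hα hμ hφ hS₀ hhf ht0.le).continuousAt
  rw [mellinInv] at hinv
  simp only [hval] at hinv
  rw [verticalLineIntegral_eq_smul, fadingLaplace]
  simp only [mul_pow] at hinv
  rw [← hinv, Complex.real_smul, Complex.real_smul, ← integral_const_mul, ← integral_const_mul,
    ← integral_const_mul]
  congr 1; ext y
  rw [Complex.ofReal_mul, Complex.mul_cpow_ofReal_nonneg hx.le hν.le, smul_eq_mul]
  push_cast
  field_simp

theorem foxHWellDefined_fading (hα : 0 < α) (hμ : 0 < μ) (hφ : 0 < φ) (hS₀ : 0 < S₀)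
    (hhf : 0 < hf) {t : ℂ} (ht : 0 < t.re) {x : ℝ} (hx : 0 < x) :
    FoxHWellDefined 1 3 (upperParams α μ φ t) (lowerParams φ)
        ((x * fadingScale α μ S₀ hf : ℝ) : ℂ) ∧
      foxH 1 3 (upperParams α μ φ t) (lowerParams φ) ((x * fadingScale α μ S₀ hf : ℝ) : ℂ) =
        2 * Real.Gamma μ / φ * Complex.Gamma t * fadingLaplace α μ φ S₀ hf (x ^ 2) t := by
  have hex : ∃ γ, FoxHSeparates 1 3 (upperParams α μ φ t) (lowerParams φ) γ := by
    have hαμ := mul_pos hα hμ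
    obtain ⟨γ, h0, h1⟩ := exists_between (show 0 < min (2 * t.re) (min φ (α * μ)) by
      refine lt_min (by linarith) (lt_min hφ hαμ))
    simp only [lt_min_iff] at h1
    exact ⟨γ, (foxHSeparates_fading hα).2 ⟨h0, h1.1, h1.2.1, h1.2.2⟩⟩
  have hval : ∀ γ, FoxHSeparates 1 3 (upperParams α μ φ t) (lowerParams φ) γ → _ := fun γ hγ => by
    obtain ⟨h0, h1, h2, h3⟩ := (foxHSeparates_fading hα).1 hγ
    exact verticalLineIntegral_foxHKernel_fading hα hμ hφ hS₀ hhf h0 h1 h2 h3 hx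
  have hfox : foxH 1 3 (upperParams α μ φ t) (lowerParams φ)
      ((x * fadingScale α μ S₀ hf : ℝ) : ℂ) =
        2 * Real.Gamma μ / φ * Complex.Gamma t * fadingLaplace α μ φ S₀ hf (x ^ 2) t := by
    rw [foxH, dif_pos hex, hval _ hex.choose_spec]
  refine ⟨⟨hex, fun γ hγ => ⟨?_, ?_⟩⟩, hfox⟩
  · obtain ⟨h0, h1, h2, h3⟩ := (foxHSeparates_fading hα).1 hγ
    exact integrable_foxHKernel_fading hα h0 h1 h2 h3 (mul_pos hx (fadingScale_pos hμ hS₀ hhf))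
  · rw [hfox, hval γ hγ]

end Fading

/-! ### Decay in the imaginary direction of `t` -/

theorem rpow_mul_one_add_rpow_neg_le_one {x δ c : ℝ} (hx : 0 < x) (hδ : 0 ≤ δ) :
    x ^ δ * (1 + x) ^ (-c) ≤ (1 + x) ^ (-(c - δ)) := by
  have h : x ^ δ ≤ (1 + x) ^ δ := Real.rpow_le_rpow hx.le (by linarith) hδ
  calc x ^ δ * (1 + x) ^ (-c) ≤ (1 + x) ^ δ * (1 + x) ^ (-c) := by gcongr
    _ = (1 + x) ^ (-(c - δ)) := by
      rw [← Real.rpow_add (by positivity)]; congr 1; ring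

/-- Decay of the Beta function `B(s, t - s)` in the imaginary direction of `t`. -/
theorem exists_norm_beta_le {δ c : ℝ} (hδ : 0 < δ) (hδ1 : δ ≤ 1) (hδc : δ < c) :
    ∃ C : ℝ, ∀ s t : ℂ, s.re = δ → t.re = c → 1 ≤ |t.im| →
      ‖Complex.Gamma s * Complex.Gamma (t - s) / Complex.Gamma t‖ ≤
        C * (1 + ‖s‖) * |t.im| ^ (-(δ / 2)) := by
  set B : ℝ := ∫ x in Set.Ioi (0 : ℝ), x ^ (δ - 1) * (1 + x) ^ (-c) with hB
  refine ⟨1 / δ + 2 + 2 * B, fun s t hs ht hr => ?_⟩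
  set r := |t.im| with hrdef
  have hr0 : 0 < r := by linarith
  have hm := hasMellin_one_add_cpow (s := s) (t := t) (by linarith) (by linarith)
  have hnorm : ∀ x : ℝ, 0 < x →
      ‖(x : ℂ) ^ (s - 1) • ((1 + x : ℝ) : ℂ) ^ (-t)‖ = x ^ (δ - 1) * (1 + x) ^ (-c) :=
    fun x hx => by
      rw [norm_smul, norm_ofReal_cpow_sub_one hx, norm_ofReal_cpow_neg (by positivity), hs, ht]
  have hBi : IntegrableOn (fun x : ℝ => x ^ (δ - 1) * (1 + x) ^ (-c)) (Set.Ioi 0) :=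
    IntegrableOn.congr_fun (Integrable.norm hm.1) (fun x hx => hnorm x hx) measurableSet_Ioi
  have hB0 : 0 ≤ B := setIntegral_nonneg measurableSet_Ioi fun x hx => by
    have : 0 < x := hx
    positivity
  -- The Beta integral is cut at `ε`. The part over `(0, ε)` is at most `ε^δ/δ`, and integration by
  -- parts beyond `ε` costs about `ε⁻¹/r`. With this `ε` they are of order `r^(-δ/2)` and
  -- `r^(-1/2)`, the latter being no larger because `δ ≤ 1`.
  set ε : ℝ := r ^ (-(1 / 2) : ℝ) with hε
  have hε0 : 0 < ε := Real.rpow_pos_of_pos hr0 _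
  have hεinv : 1 + ε⁻¹ ≤ 2 * r ^ (1 / 2 : ℝ) := by
    have : ε⁻¹ = r ^ (1 / 2 : ℝ) := by rw [hε, Real.rpow_neg hr0.le, inv_inv]
    rw [this]
    have := Real.one_le_rpow hr (show (0 : ℝ) ≤ 1 / 2 by norm_num)
    linarith
  have h1t : r ≤ ‖1 - t‖ := by
    have := Complex.abs_im_le_norm (1 - t)
    simpa [hrdef] using this
  have h1t0 : 1 - t ≠ 0 := norm_pos_iff.1 (hr0.trans_le h1t)
  -- Integrating `(1 + x)^(-t)` and differentiating `x^(s-1)` costs a factor `(1 + x)/x`, which is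
  -- at most `1 + ε⁻¹` beyond `ε`.
  have hfar : ∀ x : ℝ, ε ≤ x → x ^ (δ - 1) * (1 + x) ^ (1 - c) ≤
      (1 + ε⁻¹) * (x ^ δ * (1 + x) ^ (-c)) := fun x hx => by
    have hx0 : 0 < x := hε0.trans_le hx
    have h2 : x⁻¹ ≤ ε⁻¹ := inv_anti₀ hε0 hx
    rw [Real.rpow_sub_one hx0.ne', sub_eq_add_neg, Real.rpow_add (by positivity), Real.rpow_one]
    have h3 : x ^ δ / x * ((1 + x) * (1 + x) ^ (-c)) =
      (1 + x⁻¹) * (x ^ δ * (1 + x) ^ (-c)) := by field_simp; ring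
    rw [h3]; gcongr
  have hfar' : ∀ x : ℝ, ε ≤ x → x ^ (δ - 2) * (1 + x) ^ (1 - c) ≤
      (1 + ε⁻¹) * (x ^ (δ - 1) * (1 + x) ^ (-c)) := fun x hx => by
    have hx0 : 0 < x := hε0.trans_le hx
    have := mul_le_mul_of_nonneg_left (hfar x hx) (inv_nonneg.2 hx0.le)
    have e1 : x ^ (δ - 2) = x⁻¹ * x ^ (δ - 1) := by
      rw [← Real.rpow_neg_one, ← Real.rpow_add hx0]; congr 1; ring
    have e2 : x ^ (δ - 1) = x⁻¹ * x ^ δ := by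
      rw [← Real.rpow_neg_one, ← Real.rpow_add hx0]; congr 1; ring
    rw [e1]
    calc _ = x⁻¹ * (x ^ (δ - 1) * (1 + x) ^ (1 - c)) := by ring
      _ ≤ _ := this
      _ = _ := by rw [e2]; ring
  set f : ℝ → ℂ := fun x => (x : ℂ) ^ (s - 1) • ((1 + x : ℝ) : ℂ) ^ (-t) with hf
  -- Integration by parts in the form `A' = q + f`, with `f` the Beta integrand. Both `A` and `q`
  -- carry `1/(1 - t)`, the source of the decay; `q` also carries `s - 1`, the source of the factor
  -- `1 + ‖s‖`.
  set A : ℝ → ℂ := fun x => (x : ℂ) ^ (s - 1) * (((1 + x : ℝ) : ℂ) ^ (1 - t) / (1 - t)) with hA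
  set q : ℝ → ℂ := fun x => (s - 1) / (1 - t) *
    ((x : ℂ) ^ (s - 2) * ((1 + x : ℝ) : ℂ) ^ (1 - t)) with hq
  have hAd : ∀ x ∈ Set.Ici ε, HasDerivAt A (q x + f x) x := fun x hx => by
    have hx0 : 0 < x := hε0.trans_le hx
    have d1 : HasDerivAt (fun x : ℝ => (x : ℂ) ^ (s - 1)) ((s - 1) * (x : ℂ) ^ (s - 1 - 1)) x := by
      have := (HasDerivAt.cpow_const (c := s - 1) (hasDerivAt_id (x : ℂ))
        (Or.inl (by simpa using hx0))).comp_ofReal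
      simpa using this
    have d2 : HasDerivAt (fun x : ℝ => ((1 + x : ℝ) : ℂ) ^ (1 - t) / (1 - t))
        (((1 - t) * ((1 + x : ℝ) : ℂ) ^ (1 - t - 1)) / (1 - t)) x := by
      have h0 : HasDerivAt (fun z : ℂ => 1 + z) 1 (x : ℂ) := (hasDerivAt_id (x : ℂ)).const_add 1
      have := ((HasDerivAt.cpow_const (c := 1 - t) h0
        (Or.inl (by simp; positivity))).div_const (1 - t)).comp_ofReal
      simpa using this
    refine (d1.mul d2).congr_deriv ?_
    have e1 : s - 1 - 1 = s - 2 := by ring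
    have e2 : 1 - t - 1 = -t := by ring
    rw [mul_div_cancel_left₀ _ h1t0, e1, e2]
    simp only [hq, hf, smul_eq_mul]
    ring
  have hqn : ∀ x ∈ Set.Ioi ε, ‖q x‖ ≤
      ‖s - 1‖ / ‖1 - t‖ * (1 + ε⁻¹) * (x ^ (δ - 1) * (1 + x) ^ (-c)) := fun x hx => by
    have hx0 : 0 < x := hε0.trans hx
    have h2 : ‖(x : ℂ) ^ (s - 2)‖ = x ^ (δ - 2) := by
      rw [Complex.norm_cpow_eq_rpow_re_of_pos hx0]; simp [hs]
    have h3 : ‖((1 + x : ℝ) : ℂ) ^ (1 - t)‖ = (1 + x) ^ (1 - c) := by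
      rw [Complex.norm_cpow_eq_rpow_re_of_pos (by positivity)]; simp [ht]
    rw [norm_mul, norm_div, norm_mul, h2, h3, mul_assoc]
    exact mul_le_mul_of_nonneg_left (hfar' x hx.le) (by positivity)
  have hεsub : Set.Ioi ε ⊆ Set.Ioi 0 := Set.Ioi_subset_Ioi hε0.le
  have hqm : AEStronglyMeasurable q (volume.restrict (Set.Ioi ε)) :=
    (by fun_prop : Measurable q).aestronglyMeasurable
  have hqi : IntegrableOn q (Set.Ioi ε) := by
    refine ((hBi.mono_set hεsub).const_mul (‖s - 1‖ / ‖1 - t‖ * (1 + ε⁻¹))).mono' hqm ?_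
    filter_upwards [ae_restrict_mem measurableSet_Ioi] with x hx using hqn x hx
  have hfi : IntegrableOn f (Set.Ioi 0) := hm.1
  have hAn : ∀ x, ε ≤ x → ‖A x‖ ≤ (1 + ε⁻¹) / ‖1 - t‖ * (1 + x) ^ (-(c - δ)) := fun x hx => by
    have hx0 : 0 < x := hε0.trans_le hx
    have h3 : ‖((1 + x : ℝ) : ℂ) ^ (1 - t)‖ = (1 + x) ^ (1 - c) := by
      rw [Complex.norm_cpow_eq_rpow_re_of_pos (by positivity)]; simp [ht]
    rw [norm_mul, norm_div, norm_ofReal_cpow_sub_one hx0, h3, hs, mul_div_assoc', div_mul_eq_mul_div]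
    refine div_le_div_of_nonneg_right ?_ (norm_nonneg _)
    exact (hfar x hx).trans
      (mul_le_mul_of_nonneg_left (rpow_mul_one_add_rpow_neg_le_one hx0 hδ.le) (by positivity))
  have hAt : Filter.Tendsto A Filter.atTop (nhds 0) := by
    have h4 : Filter.Tendsto (fun x : ℝ => (1 + ε⁻¹) / ‖1 - t‖ * (1 + x) ^ (-(c - δ)))
        Filter.atTop (nhds 0) := by
      have := ((tendsto_rpow_neg_atTop (show 0 < c - δ by linarith)).comp
        (Filter.tendsto_atTop_add_const_left Filter.atTop (1 : ℝ) Filter.tendsto_id)).const_mul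
          ((1 + ε⁻¹) / ‖1 - t‖)
      simpa using this
    refine squeeze_zero_norm' ?_ h4
    filter_upwards [Filter.eventually_ge_atTop ε] with x hx using hAn x hx
  have hparts := integral_Ioi_of_hasDerivAt_of_tendsto' hAd (hqi.add (hfi.mono_set hεsub)) hAt
  have hadd : ∫ x in Set.Ioi ε, (q x + f x) = (∫ x in Set.Ioi ε, q x) + ∫ x in Set.Ioi ε, f x :=
    integral_add hqi (hfi.mono_set hεsub)
  rw [hadd] at hparts
  have hqint : ‖∫ x in Set.Ioi ε, q x‖ ≤ ‖s - 1‖ / ‖1 - t‖ * (1 + ε⁻¹) * B := by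
    refine (norm_integral_le_of_norm_le ((hBi.mono_set hεsub).const_mul
      (‖s - 1‖ / ‖1 - t‖ * (1 + ε⁻¹))) ?_).trans ?_
    · filter_upwards [ae_restrict_mem measurableSet_Ioi] with x hx using hqn x hx
    · rw [integral_const_mul]
      refine mul_le_mul_of_nonneg_left (setIntegral_mono_set hBi ?_ hεsub.eventuallyLE)
        (by positivity)
      filter_upwards [ae_restrict_mem measurableSet_Ioi] with x hx
      have : 0 < x := hx
      simp only [Pi.zero_apply]; positivity
  have hnear : ‖∫ x in Set.Ioc 0 ε, f x‖ ≤ ε ^ δ / δ := by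
    have hi : IntegrableOn (fun x : ℝ => x ^ (δ - 1)) (Set.Ioc 0 ε) :=
      (intervalIntegrable_iff_integrableOn_Ioc_of_le hε0.le).1
        (intervalIntegral.intervalIntegrable_rpow' (by linarith))
    refine (norm_integral_le_of_norm_le hi ?_).trans (le_of_eq ?_)
    · filter_upwards [ae_restrict_mem measurableSet_Ioc] with x hx
      rw [hnorm x hx.1]
      exact mul_le_of_le_one_right (Real.rpow_nonneg hx.1.le _)
        (Real.rpow_le_one_of_one_le_of_nonpos (by linarith [hx.1]) (by linarith))
    · rw [← intervalIntegral.integral_of_le hε0.le, integral_rpow (Or.inl (by linarith))]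
      simp [Real.zero_rpow hδ.ne']
  have hsplit : ∫ x in Set.Ioi 0, f x = (∫ x in Set.Ioc 0 ε, f x) + ∫ x in Set.Ioi ε, f x := by
    rw [← setIntegral_union (Set.Ioc_disjoint_Ioi le_rfl) measurableSet_Ioi
      (hfi.mono_set Set.Ioc_subset_Ioi_self) (hfi.mono_set hεsub),
      Set.Ioc_union_Ioi_eq_Ioi hε0.le]
  have hm2 := hm.2
  rw [mellin] at hm2
  rw [← hm2, hsplit]
  have hfar_eq : ∫ x in Set.Ioi ε, f x = -A ε - ∫ x in Set.Ioi ε, q x := by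
    linear_combination hparts
  have hAε : ‖A ε‖ ≤ (1 + ε⁻¹) / ‖1 - t‖ := by
    refine (hAn ε le_rfl).trans (mul_le_of_le_one_right (by positivity) ?_)
    exact Real.rpow_le_one_of_one_le_of_nonpos (by linarith) (by linarith)
  have hεr : (1 + ε⁻¹) / ‖1 - t‖ ≤ 2 * r ^ (-(δ / 2)) := by
    calc (1 + ε⁻¹) / ‖1 - t‖ ≤ 2 * r ^ (1 / 2 : ℝ) / r := by gcongr
      _ = 2 * r ^ (-(1 / 2) : ℝ) := by
        rw [mul_div_assoc, ← Real.rpow_sub_one hr0.ne']; norm_num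
      _ ≤ 2 * r ^ (-(δ / 2)) := by
        have := Real.rpow_le_rpow_of_exponent_le hr (show (-(1 / 2) : ℝ) ≤ -(δ / 2) by linarith)
        linarith
  have hεδ : ε ^ δ = r ^ (-(δ / 2)) := by
    rw [hε, ← Real.rpow_mul hr0.le]; congr 1; ring
  have hs1 : ‖s - 1‖ ≤ 1 + ‖s‖ := by
    refine (norm_sub_le _ _).trans ?_
    simp [add_comm]
  rw [hfar_eq]
  rw [hεδ] at hnear
  have hq2 : ‖s - 1‖ / ‖1 - t‖ * (1 + ε⁻¹) * B ≤ (1 + ‖s‖) * (2 * r ^ (-(δ / 2))) * B := by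
    have : ‖s - 1‖ / ‖1 - t‖ * (1 + ε⁻¹) = ‖s - 1‖ * ((1 + ε⁻¹) / ‖1 - t‖) := by ring
    rw [this]; gcongr
  set ρ := r ^ (-(δ / 2)) with hρ
  have hρ0 : 0 < ρ := Real.rpow_pos_of_pos hr0 _
  have hs0 := norm_nonneg s
  calc _ ≤ ‖∫ x in Set.Ioc 0 ε, f x‖ + (‖A ε‖ + ‖∫ x in Set.Ioi ε, q x‖) := by
        refine (norm_add_le _ _).trans ?_
        gcongr
        refine (norm_sub_le _ _).trans ?_
        rw [norm_neg]
    _ ≤ ρ / δ + (2 * ρ + (1 + ‖s‖) * (2 * ρ) * B) := by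
        gcongr
        · exact hAε.trans hεr
        · exact hqint.trans hq2
    _ ≤ (1 / δ + 2 + 2 * B) * (1 + ‖s‖) * ρ := by
        have h5 : 0 ≤ (1 / δ + 2) * ‖s‖ * ρ := by positivity
        have h6 : ρ / δ = 1 / δ * ρ := by ring
        rw [h6]; nlinarith

section Fading

variable {α μ φ S₀ hf : ℝ}

/-- The Beta bound is applied under the Mellin-Barnes integral. Its growth `1 + ‖s/2‖` is absorbed
by `1/(φ - s)`, which leaves the integrable factor `Γ(μ - s/α)`. -/
theorem norm_fadingLaplace_le_rpow (hα : 0 < α) (hμ : 0 < μ) (hφ : 0 < φ) (hS₀ : 0 < S₀)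
    (hhf : 0 < hf) {κ c : ℝ} (hκ : 0 < κ) (hc : 0 < c) :
    ∃ C δ : ℝ, 0 < δ ∧ ∀ t : ℂ, t.re = c → 1 ≤ |t.im| →
      ‖fadingLaplace α μ φ S₀ hf κ t‖ ≤ C * |t.im| ^ (-δ) := by
  have hαμ := mul_pos hα hμ
  -- Besides separating the poles, `γ < 2` is imposed so that the Beta bound applies with `δ = γ/2 ≤
  -- 1`.
  obtain ⟨γ, h0, h1⟩ := exists_between (show 0 < min (min 2 (2 * c)) (min φ (α * μ)) from
    lt_min (lt_min two_pos (by linarith)) (lt_min hφ hαμ))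
  simp only [lt_min_iff] at h1
  obtain ⟨⟨hγ2, hγc⟩, hγφ, hγμ⟩ := h1
  obtain ⟨C, hC⟩ := exists_norm_beta_le (δ := γ / 2) (c := c) (by linarith) (by linarith)
    (by linarith)
  have hν := fadingScale_pos (α := α) hμ hS₀ hhf
  set x := Real.sqrt κ with hx
  have hx0 : 0 < x := Real.sqrt_pos.2 hκ
  have hxκ : x ^ 2 = κ := Real.sq_sqrt hκ.le
  set z := x * fadingScale α μ S₀ hf with hz
  have hz0 : 0 < z := mul_pos hx0 hν
  have hre : ∀ y : ℝ, ((γ : ℂ) + y * Complex.I).re = γ := fun y => by simp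
  have hg := integrable_Gamma_vertical (a := μ - γ / α) (b := -α⁻¹)
    (by rw [sub_pos, div_lt_iff₀ hα]; linarith) (neg_ne_zero.2 (inv_ne_zero hα.ne'))
  have harg : ∀ y : ℝ, (((μ - γ / α : ℝ) : ℂ) + ((-α⁻¹ * y : ℝ) : ℂ) * Complex.I) =
      μ - (γ + y * Complex.I) / α := fun y => by push_cast; ring
  simp only [harg] at hg
  set G := ∫ y : ℝ, ‖Complex.Gamma (μ - (γ + y * Complex.I) / α)‖ with hG
  -- `D` bounds `(1 + ‖s/2‖)/‖φ - s‖`, because `‖s/2‖ ≤ φ + ‖φ - s‖` and `‖φ - s‖ ≥ φ - γ`.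
  set D := 1 + (1 + φ) / (φ - γ) with hD
  refine ⟨φ / (2 * Real.Gamma μ) * (1 / (2 * Real.pi)) * (|C| * D * z ^ (-γ)) * G, γ / 2 / 2,
    by linarith, fun t ht hr => ?_⟩
  have ht0 : 0 < t.re := by linarith
  set r := |t.im| with hrdef
  have hr0 : 0 < r := by linarith
  have hv := verticalLineIntegral_foxHKernel_fading (t := t) hα hμ hφ hS₀ hhf h0
    (by linarith) hγφ hγμ hx0
  rw [hxκ, ← hz] at hv
  have hΓt : Complex.Gamma t ≠ 0 := Complex.Gamma_ne_zero_of_re_pos ht0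
  have hΓμ0 := Real.Gamma_pos_of_pos hμ
  have hΓμ : (Real.Gamma μ : ℂ) ≠ 0 := by exact_mod_cast hΓμ0.ne'
  have hφ0 : (φ : ℂ) ≠ 0 := by exact_mod_cast hφ.ne'
  have hL : fadingLaplace α μ φ S₀ hf κ t = ((φ / (2 * Real.Gamma μ) * (1 / (2 * Real.pi)) : ℝ) : ℂ) *
      ∫ y : ℝ, (foxHKernel 1 3 (upperParams α μ φ t) (lowerParams φ) (γ + y * Complex.I) *
        (z : ℂ) ^ (-((γ : ℂ) + y * Complex.I))) / Complex.Gamma t := by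
    rw [verticalLineIntegral_eq_smul, Complex.real_smul] at hv
    rw [integral_div, Complex.ofReal_mul, mul_assoc, ← mul_div_assoc, hv]
    push_cast
    field_simp
  have hbd : ∀ y : ℝ, ‖(foxHKernel 1 3 (upperParams α μ φ t) (lowerParams φ) (γ + y * Complex.I) *
        (z : ℂ) ^ (-((γ : ℂ) + y * Complex.I))) / Complex.Gamma t‖ ≤
      (|C| * D * z ^ (-γ) * r ^ (-(γ / 2 / 2))) *
        ‖Complex.Gamma (μ - (γ + y * Complex.I) / α)‖ := fun y => by
    set s : ℂ := γ + y * Complex.I with hs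
    have hsre : s.re = γ := hre y
    have hs2 : (s / 2).re = γ / 2 := by simp [hsre]
    have hb := hC (s / 2) t hs2 ht hr
    have hφs : φ - γ ≤ ‖(φ - s : ℂ)‖ := by
      have := Complex.re_le_norm (φ - s)
      rwa [Complex.sub_re, hsre, Complex.ofReal_re] at this
    have hφγ : 0 < φ - γ := by linarith
    have hφs0 : 0 < ‖(φ - s : ℂ)‖ := hφγ.trans_le hφs
    have hsD : (1 + ‖s / 2‖) / ‖(φ - s : ℂ)‖ ≤ D := by
      have h3 : ‖s / 2‖ ≤ φ + ‖(φ - s : ℂ)‖ := by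
        have h4 : ‖s / 2‖ ≤ ‖s‖ := by
          rw [norm_div]; simp
        have h5 : ‖s‖ ≤ ‖(φ : ℂ)‖ + ‖(φ - s : ℂ)‖ := by
          have := norm_sub_le (φ : ℂ) (φ - s)
          simpa using this
        rw [Complex.norm_real, Real.norm_eq_abs, abs_of_pos hφ] at h5
        linarith
      rw [div_le_iff₀ hφs0, hD, add_mul, one_mul]
      have : 1 + φ ≤ (1 + φ) / (φ - γ) * ‖(φ - s : ℂ)‖ := by
        rw [div_mul_eq_mul_div, le_div_iff₀ hφγ]; gcongr
      linarith
    rw [foxHKernel_fading (by rw [hsre]; exact hγφ)]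
    have e : Complex.Gamma (s / 2) * Complex.Gamma (t - s / 2) *
        (Complex.Gamma (μ - s / α) / (φ - s)) * (z : ℂ) ^ (-s) / Complex.Gamma t =
        (Complex.Gamma (s / 2) * Complex.Gamma (t - s / 2) / Complex.Gamma t) *
        (Complex.Gamma (μ - s / α) / (φ - s)) * (z : ℂ) ^ (-s) := by ring
    rw [e, norm_mul, norm_mul, norm_div (Complex.Gamma (μ - s / α)), norm_ofReal_cpow_neg hz0, hsre]
    have hC' : C * (1 + ‖s / 2‖) * r ^ (-(γ / 2 / 2)) ≤
        |C| * (1 + ‖s / 2‖) * r ^ (-(γ / 2 / 2)) := by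
      gcongr; exact le_abs_self C
    calc _ ≤ (|C| * (1 + ‖s / 2‖) * r ^ (-(γ / 2 / 2))) *
          (‖Complex.Gamma (μ - s / α)‖ / ‖(φ - s : ℂ)‖) * z ^ (-γ) := by
          gcongr; exact hb.trans hC'
      _ = (|C| * ((1 + ‖s / 2‖) / ‖(φ - s : ℂ)‖) * z ^ (-γ) * r ^ (-(γ / 2 / 2))) *
          ‖Complex.Gamma (μ - s / α)‖ := by ring
      _ ≤ _ := by gcongr
  have hint := norm_integral_le_of_norm_le (hg.norm.const_mul _) (Filter.Eventually.of_forall hbd)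
  rw [integral_const_mul] at hint
  rw [hL, norm_mul, Complex.norm_real, Real.norm_eq_abs, abs_of_pos (by positivity)]
  calc _ ≤ _ := mul_le_mul_of_nonneg_left hint (by positivity)
    _ = _ := by ring

end Fading

/-- Polynomial decay of `L` along a vertical line makes `L(t) / t` absolutely integrable there. -/
theorem integrableOnVerticalLine_div {L : ℂ → ℂ} {c C δ : ℝ} (hc : 0 < c) (hδ : 0 < δ)
    (hL : Continuous fun y : ℝ => L (c + y * Complex.I))
    (hL1 : ∀ t : ℂ, t.re = c → ‖L t‖ ≤ 1)
    (hLd : ∀ t : ℂ, t.re = c → 1 ≤ |t.im| → ‖L t‖ ≤ C * |t.im| ^ (-δ)) :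
    IntegrableOnVerticalLine c (fun t => L t / t) := by
  have hre : ∀ y : ℝ, ((c : ℂ) + y * Complex.I).re = c := fun y => by simp
  have him : ∀ y : ℝ, ((c : ℂ) + y * Complex.I).im = y := fun y => by simp
  have hne : ∀ y : ℝ, (c : ℂ) + y * Complex.I ≠ 0 := fun y h => by
    have := hre y
    rw [h] at this; simp at this; exact hc.ne this
  -- The majorant covers both ranges: `1 + |y| ≤ 2|y|` when `|y| ≥ 1`, and `1 + |y| ≤ 2` otherwise,
  -- where `‖L‖ ≤ 1` and `‖t‖ ≥ c` give `1/c`.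
  have hint := (integrable_one_add_norm (E := ℝ) (μ := volume) (r := 1 + δ) (by simp [hδ])).const_mul
    ((|C| + 1 / c) * 2 ^ (1 + δ))
  refine hint.mono' (hL.div (by fun_prop) hne).aestronglyMeasurable
    (Filter.Eventually.of_forall fun y => ?_)
  rw [norm_div, Real.norm_eq_abs]
  set t : ℂ := c + y * Complex.I with ht
  have ha : 0 < 1 + |y| := by positivity
  have h2 : (0 : ℝ) < 2 ^ (1 + δ) := by positivity
  have htc : c ≤ ‖t‖ := by simpa [ht] using Complex.re_le_norm t
  have hty : |y| ≤ ‖t‖ := by simpa [ht] using Complex.abs_im_le_norm t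
  have htwo : ∀ u : ℝ, 0 < u → 1 + |y| ≤ 2 * u →
      u ^ (-(1 + δ)) ≤ 2 ^ (1 + δ) * (1 + |y|) ^ (-(1 + δ)) := fun u hu h => by
    have h3 : (1 + |y|) / 2 ≤ u := by linarith
    have h4 := Real.rpow_le_rpow_of_nonpos (by positivity) h3 (show -(1 + δ) ≤ 0 by linarith)
    rwa [Real.div_rpow ha.le two_pos.le, Real.rpow_neg two_pos.le, div_inv_eq_mul, mul_comm] at h4
  rcases le_or_gt 1 |y| with hy | hy
  · have hy0 : 0 < |y| := by linarith
    have h1 := hLd t (hre y) (by rwa [him])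
    rw [him] at h1
    have h1' : ‖L t‖ ≤ |C| * |y| ^ (-δ) := h1.trans (by gcongr; exact le_abs_self C)
    calc ‖L t‖ / ‖t‖ ≤ |C| * |y| ^ (-δ) / |y| := by gcongr
      _ = |C| * |y| ^ (-(1 + δ)) := by
        rw [mul_div_assoc, ← Real.rpow_sub_one hy0.ne']; congr 2; ring
      _ ≤ (|C| + 1 / c) * (2 ^ (1 + δ) * (1 + |y|) ^ (-(1 + δ))) := by
        have h5 := htwo |y| hy0 (by linarith)
        have : 0 < 1 / c := by positivity
        gcongr
        linarith
      _ = _ := by ring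
  · have h5 := htwo 1 one_pos (by linarith)
    rw [Real.one_rpow] at h5
    calc ‖L t‖ / ‖t‖ ≤ 1 / c := by gcongr; exact hL1 t (hre y)
      _ = 1 / c * 1 := by ring
      _ ≤ (|C| + 1 / c) * (2 ^ (1 + δ) * (1 + |y|) ^ (-(1 + δ))) := by
        have := abs_nonneg C
        gcongr
        linarith
      _ = _ := by ring

/-! ### Integrability of the product of the Laplace factors -/

section Fading

variable {α μ φ S₀ hf : ℝ}

theorem aestronglyMeasurable_fadingPDF (hα : 0 < α) (hμ : 0 < μ) (hφ : 0 < φ) (hS₀ : 0 < S₀)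
    (hhf : 0 < hf) : AEStronglyMeasurable (fadingPDF α μ φ S₀ hf) volume := by
  have h := (integrableOn_fadingPDF (α := α) hα hμ hφ hS₀ hhf).aestronglyMeasurable
  rw [← aestronglyMeasurable_indicator_iff measurableSet_Ioi] at h
  refine h.congr (Filter.Eventually.of_forall fun x => ?_)
  by_cases hx : 0 < x
  · simp [hx]
  · simp [hx, fadingPDF]

/-- The moment formula at `s = 0`; the normalisation is what bounds each Laplace factor by 1. -/
theorem integral_fadingPDF (hα : 0 < α) (hμ : 0 < μ) (hφ : 0 < φ) (hS₀ : 0 < S₀)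
    (hhf : 0 < hf) : ∫ x in Set.Ioi (0 : ℝ), fadingPDF α μ φ S₀ hf x = 1 := by
  have h := (fadingPDF_moment hα hμ hφ hS₀ hhf (s := 0) (by simpa using hφ)
    (by simpa using mul_pos hα hμ)).2
  have hΓ : (Real.Gamma μ : ℂ) ≠ 0 := by exact_mod_cast (Real.Gamma_pos_of_pos hμ).ne'
  have hφ0 : (φ : ℂ) ≠ 0 := by exact_mod_cast hφ.ne'
  simp only [neg_zero, Complex.cpow_zero, mul_one, zero_div, sub_zero] at h
  rw [Complex.Gamma_ofReal, integral_complex_ofReal] at h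
  have h1 : (φ / Real.Gamma μ * (Real.Gamma μ / φ) : ℂ) = 1 := by field_simp
  rw [h1] at h
  exact_mod_cast h

theorem continuous_one_add_cpow_neg {x : ℝ} (hx : 0 ≤ x) :
    Continuous fun t : ℂ => ((1 + x : ℝ) : ℂ) ^ (-t) :=
  Continuous.const_cpow (by fun_prop) (Or.inl (by exact_mod_cast (by positivity : 1 + x ≠ 0)))

theorem norm_fadingLaplace_le_one (hα : 0 < α) (hμ : 0 < μ) (hφ : 0 < φ) (hS₀ : 0 < S₀)
    (hhf : 0 < hf) {κ : ℝ} (hκ : 0 ≤ κ) {t : ℂ} (ht : 0 ≤ t.re) :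
    ‖fadingLaplace α μ φ S₀ hf κ t‖ ≤ 1 := by
  rw [← integral_fadingPDF (α := α) hα hμ hφ hS₀ hhf]
  refine norm_integral_le_of_norm_le (integrableOn_fadingPDF hα hμ hφ hS₀ hhf)
    (Filter.Eventually.of_forall fun y => ?_)
  rw [norm_mul, Complex.norm_real, Real.norm_eq_abs, abs_of_nonneg
    (fadingPDF_nonneg hμ hφ hS₀ hhf y)]
  exact mul_le_of_le_one_right (fadingPDF_nonneg hμ hφ hS₀ hhf y)
    (ofReal_one_add_cpow_norm_le_one (by positivity) ht)

theorem continuous_fadingLaplace_vertical (hα : 0 < α) (hμ : 0 < μ) (hφ : 0 < φ) (hS₀ : 0 < S₀)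
    (hhf : 0 < hf) {κ c : ℝ} (hκ : 0 ≤ κ) (hc : 0 ≤ c) :
    Continuous fun y : ℝ => fadingLaplace α μ φ S₀ hf κ (c + y * Complex.I) := by
  have hi := (integrableOn_fadingPDF (α := α) hα hμ hφ hS₀ hhf).ofReal (𝕜 := ℂ)
  refine continuous_of_dominated (fun y => ?_) (fun y => ?_) hi.norm ?_
  · refine hi.aestronglyMeasurable.mul ?_
    exact (by fun_prop : Measurable fun x : ℝ =>
      ((1 + κ * x ^ 2 : ℝ) : ℂ) ^ (-(c + y * Complex.I))).aestronglyMeasurable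
  · refine Filter.Eventually.of_forall fun x => ?_
    rw [norm_mul]
    exact mul_le_of_le_one_right (norm_nonneg _)
      (ofReal_one_add_cpow_norm_le_one (by positivity) (by simpa using hc))
  · exact Filter.Eventually.of_forall fun x => continuous_const.mul
      ((continuous_one_add_cpow_neg (by positivity)).comp (by fun_prop))

theorem integrableOnVerticalLine_prod_fadingLaplace (hα : 0 < α) (hμ : 0 < μ) (hφ : 0 < φ)
    (hS₀ : 0 < S₀) (hhf : 0 < hf) {K : ℕ} (hK : 1 ≤ K) {κ : Fin K → ℝ} (hκ : ∀ k, 0 < κ k)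
    {c : ℝ} (hc : 0 < c) :
    IntegrableOnVerticalLine c (fun t => (∏ k, fadingLaplace α μ φ S₀ hf (κ k) t) / t) := by
  -- Decay of a single factor is enough, the others being bounded by 1; this is where `K ≥ 1`
  -- enters.
  set k₀ : Fin K := ⟨0, hK⟩
  obtain ⟨C, δ, hδ, hC⟩ := norm_fadingLaplace_le_rpow (α := α) hα hμ hφ hS₀ hhf (hκ k₀) hc
  have h1 : ∀ t : ℂ, t.re = c → ∀ k, ‖fadingLaplace α μ φ S₀ hf (κ k) t‖ ≤ 1 := fun t ht k =>
    norm_fadingLaplace_le_one hα hμ hφ hS₀ hhf (hκ k).le (by rw [ht]; exact hc.le)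
  refine integrableOnVerticalLine_div (C := C) hc hδ
    (continuous_finsetProd _ fun k _ =>
      continuous_fadingLaplace_vertical hα hμ hφ hS₀ hhf (hκ k).le hc.le)
    (fun t ht => ?_) (fun t ht hr => ?_)
  · rw [norm_prod]
    exact Finset.prod_le_one (fun _ _ => norm_nonneg _) fun k _ => h1 t ht k
  · rw [norm_prod, ← Finset.mul_prod_erase _ _ (Finset.mem_univ k₀)]
    refine (mul_le_of_le_one_right (norm_nonneg _) ?_).trans (hC t ht hr)
    exact Finset.prod_le_one (fun _ _ => norm_nonneg _) fun k _ => h1 t ht k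

end Fading

/-! ### Laplace inversion for distribution functions -/

section Probability

variable {Ω : Type*} [MeasurableSpace Ω] {P : Measure Ω}

/-- A sum of independent random variables one of which has no atoms has no atoms. -/
theorem measure_sum_eq_zero_of_iIndepFun [IsProbabilityMeasure P] {ι : Type*} [Fintype ι]
    [DecidableEq ι] {X : ι → Ω → ℝ} (hX : ∀ i, Measurable (X i)) (hind : iIndepFun X P) (i₀ : ι)
    (hatom : ∀ r, P {ω | X i₀ ω = r} = 0) (v : ℝ) : P {ω | ∑ i, X i ω = v} = 0 := by
  set S : Ω → ℝ := ∑ j ∈ Finset.univ.erase i₀, X j with hS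
  have hSm : Measurable S := by
    have : S = fun ω => ∑ j ∈ Finset.univ.erase i₀, X j ω := by
      ext ω; rw [hS, Finset.sum_apply]
    rw [this]; exact Finset.measurable_sum _ fun i _ => hX i
  have hi : IndepFun S (X i₀) P :=
    hind.indepFun_finsetSum_of_notMem hX (Finset.notMem_erase i₀ _)
  have hmap := (indepFun_iff_map_prod_eq_prod_map_map hSm.aemeasurable (hX i₀).aemeasurable).1 hi
  have hset : MeasurableSet {p : ℝ × ℝ | p.1 + p.2 = v} :=
    measurableSet_eq_fun (by fun_prop) measurable_const
  have hpre : {ω | ∑ i, X i ω = v} = (fun ω => (S ω, X i₀ ω)) ⁻¹' {p : ℝ × ℝ | p.1 + p.2 = v} := by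
    ext ω
    rw [Set.mem_preimage, Set.mem_ofPred_eq, Set.mem_ofPred_eq, hS, Finset.sum_apply,
      Finset.sum_erase_add _ _ (Finset.mem_univ i₀)]
  rw [hpre, ← Measure.map_apply (hSm.prodMk (hX i₀)) hset, hmap,
    Measure.measure_prod_null hset]
  -- Under the product law, the section over the value `a` of the remaining sum is the single point
  -- `v - a`.
  refine Filter.Eventually.of_forall fun a => ?_
  have : Prod.mk a ⁻¹' {p : ℝ × ℝ | p.1 + p.2 = v} = {v - a} := by
    ext b
    simp only [Set.mem_preimage, Set.mem_ofPred_eq, Set.mem_singleton_iff]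
    constructor <;> intro h <;> linarith
  simp only [this, Pi.zero_apply]
  rw [Measure.map_apply (hX i₀) (measurableSet_singleton _)]
  exact hatom (v - a)

/-- Laplace inversion for the distribution function of a nonnegative random variable. -/
theorem measureReal_lt_eq_verticalLineIntegral [IsProbabilityMeasure P] {V : Ω → ℝ}
    (hV : Measurable V) (hV0 : ∀ ω, 0 ≤ V ω) {v c : ℝ} (hc : 0 < c) (hatom : P {ω | V ω = v} = 0)
    (hint : IntegrableOnVerticalLine c (fun t => (∫ ω, Complex.exp (-t * V ω) ∂P) / t)) :
    (P.real {ω | V ω < v} : ℂ) =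
      verticalLineIntegral c (fun t => (∫ ω, Complex.exp (-t * V ω) ∂P) / t * Complex.exp (t * v)) := by
  -- With `x = e^(-v)`, `ψ(x e^V)` is the indicator of `V < v`, so Laplace inversion in `v` becomes
  -- Mellin inversion in `x` of an average of dilates.
  set ψ : ℝ → ℂ := (Set.Ioo (0 : ℝ) 1).indicator fun _ => 1 with hψ
  have hcpow : ∀ (s : ℂ) (ω : Ω), ((Real.exp (V ω) : ℝ) : ℂ) ^ (-s) = Complex.exp (-s * V ω) :=
    fun s ω => by
    rw [Complex.cpow_def_of_ne_zero (by exact_mod_cast (Real.exp_pos _).ne'),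
      ← Complex.ofReal_log (Real.exp_pos _).le, Real.log_exp, mul_comm]
  have hM : ∀ s : ℂ, 0 < s.re → HasMellin (fun x => ∫ ω, ψ (x * Real.exp (V ω)) ∂P) s
      ((∫ ω, Complex.exp (-s * V ω) ∂P) / s) := fun s hs => by
    have h := hasMellin_integral_comp_mul (P := P) (g := fun _ => 1)
      (W := fun ω => Real.exp (V ω)) (by fun_prop)
      (Filter.Eventually.of_forall fun ω => Real.exp_pos _) aestronglyMeasurable_const
      (measurable_const.indicator measurableSet_Ioo) (hasMellin_one_Ioo hs) (by
        simp only [one_mul, hcpow]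
        refine Integrable.of_bound (C := 1)
          (by fun_prop : Measurable fun ω => Complex.exp (-s * V ω)).aestronglyMeasurable
          (Filter.Eventually.of_forall fun ω => ?_)
        rw [Complex.norm_exp]
        have := mul_nonneg hs.le (hV0 ω)
        simpa using this)
    simp only [one_mul, hcpow, mul_one_div] at h
    exact h
  set x₀ := Real.exp (-v) with hx₀
  have hx₀0 : 0 < x₀ := Real.exp_pos _
  have hψm : Measurable ψ := measurable_const.indicator measurableSet_Ioo
  -- On positive arguments `ψ` jumps only at 1, that is where `V = v`, a null event by `hatom`.
  have hcont : ContinuousAt (fun x => ∫ ω, ψ (x * Real.exp (V ω)) ∂P) x₀ := by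
    refine continuousAt_of_dominated (bound := fun _ => 1) ?_ ?_ (integrable_const _) ?_
    · exact Filter.Eventually.of_forall fun x => (hψm.comp (by fun_prop)).aestronglyMeasurable
    · refine Filter.Eventually.of_forall fun x => Filter.Eventually.of_forall fun ω => ?_
      simp only [hψ, Set.indicator]; split_ifs <;> simp
    · have : ∀ᵐ ω ∂P, V ω ≠ v := by rw [ae_iff]; simpa using hatom
      filter_upwards [this] with ω hω
      have hu0 : 0 < x₀ * Real.exp (V ω) := by positivity
      have hu1 : x₀ * Real.exp (V ω) ≠ 1 := by
        rw [hx₀, ← Real.exp_add, Ne, Real.exp_eq_one_iff]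
        intro h; apply hω; linarith
      have hψc : ContinuousAt ψ (x₀ * Real.exp (V ω)) := by
        rcases lt_or_gt_of_ne hu1 with h | h
        · refine (continuousAt_const (y := (1 : ℂ))).congr ?_
          filter_upwards [Ioo_mem_nhds hu0 h] with u hu
          simp only [hψ, Set.indicator_of_mem hu]
        · refine (continuousAt_const (y := (0 : ℂ))).congr ?_
          filter_upwards [Ioi_mem_nhds h] with u hu
          have hu : 1 < u := hu
          have : u ∉ Set.Ioo (0 : ℝ) 1 := fun h' => lt_asymm hu h'.2
          simp only [hψ, Set.indicator_of_notMem this]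
      exact ContinuousAt.comp (f := fun x => x * Real.exp (V ω)) hψc (by fun_prop)
  have hre : ∀ y : ℝ, ((c : ℂ) + y * Complex.I).re = c := fun y => by simp
  have hval : ∀ y : ℝ, _ := fun y => (hM (c + y * Complex.I) (by rwa [hre])).2
  have hinv := mellinInv_mellin_eq c _ hx₀0 (hM c (by simpa using hc)).1
    (by
      rw [Complex.VerticalIntegrable]
      simp only [hval]
      exact hint) hcont
  rw [mellinInv] at hinv
  simp only [hval] at hinv
  have hprob : ∫ ω, ψ (x₀ * Real.exp (V ω)) ∂P = (P.real {ω | V ω < v} : ℂ) := by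
    have hmeas : MeasurableSet {ω | V ω < v} := measurableSet_lt hV measurable_const
    have e : ∀ ω, ψ (x₀ * Real.exp (V ω)) = ({ω | V ω < v}.indicator (fun _ => (1 : ℂ))) ω :=
      fun ω => by
      have hu0 : 0 < x₀ * Real.exp (V ω) := by positivity
      have hiff : x₀ * Real.exp (V ω) < 1 ↔ V ω < v := by
        rw [hx₀, ← Real.exp_add, Real.exp_lt_one_iff]
        constructor <;> intro h <;> linarith
      simp only [hψ, Set.indicator, Set.mem_Ioo, hu0, true_and, hiff, Set.mem_ofPred_eq]
    simp only [e]
    rw [integral_indicator hmeas]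
    simp
  rw [← hprob, ← hinv, verticalLineIntegral_eq_smul]
  congr 2; ext y
  rw [smul_eq_mul, mul_comm]
  congr 1
  rw [hx₀, Complex.cpow_def_of_ne_zero (by exact_mod_cast (Real.exp_pos _).ne'),
    ← Complex.ofReal_log (Real.exp_pos _).le, Real.log_exp]
  congr 1; push_cast; ring

end Probability

/-! ### A single round, and the outage formula -/

section Probability

variable {Ω : Type*} [MeasurableSpace Ω] {P : Measure Ω} {α μ φ S₀ hf : ℝ} {h : Ω → ℂ}

/-- Mutual information, in nats, of a single round. -/
noncomputable def roundInformation (κ x : ℝ) : ℝ := Real.log (1 + κ * x ^ 2)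

theorem measurable_roundInformation (κ : ℝ) : Measurable (roundInformation κ) := by
  unfold roundInformation; fun_prop

theorem roundInformation_nonneg {κ : ℝ} (hκ : 0 ≤ κ) (x : ℝ) : 0 ≤ roundInformation κ x :=
  Real.log_nonneg (by nlinarith [mul_nonneg hκ (sq_nonneg x)])

theorem exp_neg_mul_roundInformation {κ : ℝ} (hκ : 0 ≤ κ) (t : ℂ) (x : ℝ) :
    Complex.exp (-t * roundInformation κ x) = ((1 + κ * x ^ 2 : ℝ) : ℂ) ^ (-t) := by
  have hp : 0 < 1 + κ * x ^ 2 := by positivity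
  rw [Complex.cpow_def_of_ne_zero (by exact_mod_cast hp.ne'), ← Complex.ofReal_log hp.le,
    roundInformation, mul_comm]

theorem integral_exp_roundInformation (hα : 0 < α) (hμ : 0 < μ) (hφ : 0 < φ) (hS₀ : 0 < S₀)
    (hhf : 0 < hf) (hmeas : Measurable h)
    (hpdf : Measure.map (fun ω => ‖h ω‖) P =
      volume.withDensity (fun x => ENNReal.ofReal (fadingPDF α μ φ S₀ hf x)))
    {κ : ℝ} (hκ : 0 ≤ κ) (t : ℂ) :
    ∫ ω, Complex.exp (-t * roundInformation κ ‖h ω‖) ∂P = fadingLaplace α μ φ S₀ hf κ t := by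
  have hm := measurable_roundInformation κ
  rw [← integral_map (φ := fun ω => ‖h ω‖) (f := fun x => Complex.exp (-t * roundInformation κ x))
    hmeas.norm.aemeasurable (by fun_prop), hpdf,
    integral_withDensity_eq_integral_toReal_smul₀
      (aestronglyMeasurable_fadingPDF hα hμ hφ hS₀ hhf).aemeasurable.ennreal_ofReal
      (Filter.Eventually.of_forall fun _ => ENNReal.ofReal_lt_top),
    fadingLaplace, ← integral_indicator measurableSet_Ioi]
  congr 1; ext x
  rw [ENNReal.toReal_ofReal (fadingPDF_nonneg hμ hφ hS₀ hhf x), exp_neg_mul_roundInformation hκ,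
    Complex.real_smul]
  by_cases hx : 0 < x
  · rw [Set.indicator_of_mem (Set.mem_Ioi.2 hx)]
  · rw [Set.indicator_of_notMem (by simpa using hx)]
    simp [fadingPDF, hx]

/-- As `κ > 0`, the value `r` determines `‖h‖`, whose law is absolutely continuous. -/
theorem measure_roundInformation_eq_zero (hmeas : Measurable h)
    (hpdf : Measure.map (fun ω => ‖h ω‖) P =
      volume.withDensity (fun x => ENNReal.ofReal (fadingPDF α μ φ S₀ hf x)))
    {κ : ℝ} (hκ : 0 < κ) (r : ℝ) : P {ω | roundInformation κ ‖h ω‖ = r} = 0 := by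
  have hsub : {ω | roundInformation κ ‖h ω‖ = r} ⊆
      (fun ω => ‖h ω‖) ⁻¹' {Real.sqrt ((Real.exp r - 1) / κ)} := fun ω hω => by
    have hω : Real.log (1 + κ * ‖h ω‖ ^ 2) = r := hω
    have hp : 0 < 1 + κ * ‖h ω‖ ^ 2 := by positivity
    rw [Set.mem_preimage, Set.mem_singleton_iff, ← hω, Real.exp_log hp, add_sub_cancel_left,
      mul_div_cancel_left₀ _ hκ.ne', Real.sqrt_sq (norm_nonneg _)]
  refine measure_mono_null hsub ?_
  rw [← Measure.map_apply hmeas.norm (measurableSet_singleton _), hpdf]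
  exact withDensity_absolutelyContinuous _ _ (by simp)

end Probability

/-- Each Fox function equals `2Γ(μ)/φ · Γ(t)` times a Laplace factor; the division by `Γ(t)` leaves
one constant per round. -/
theorem outageTransform_eq {K : ℕ} {α μ φ S₀ hf : ℝ} (hα : 0 < α) (hμ : 0 < μ) (hφ : 0 < φ)
    (hS₀ : 0 < S₀) (hhf : 0 < hf) {hl : ℂ} (hhl : hl ≠ 0) {ρ : Fin K → ℝ} (hρ : ∀ k, 0 < ρ k)
    {t : ℂ} (ht : 0 < t.re) :
    outageTransform α μ φ S₀ hf hl ρ t = (2 * Real.Gamma μ / φ) ^ K *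
      ((∏ k, fadingLaplace α μ φ S₀ hf (ρ k * ‖hl‖ ^ 2) t) / t) := by
  have hΓt : Complex.Gamma t ≠ 0 := Complex.Gamma_ne_zero_of_re_pos ht
  have hk : ∀ k, foxH 1 3 (upperParams α μ φ t) (lowerParams φ)
      (foxArgument α μ S₀ hf hl (ρ k) : ℂ) / Complex.Gamma t =
      2 * Real.Gamma μ / φ * fadingLaplace α μ φ S₀ hf (ρ k * ‖hl‖ ^ 2) t := fun k => by
    have hκ : 0 < ρ k * ‖hl‖ ^ 2 := mul_pos (hρ k) (pow_pos (norm_pos_iff.2 hhl) 2)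
    have h := (foxHWellDefined_fading (α := α) hα hμ hφ hS₀ hhf ht (Real.sqrt_pos.2 hκ)).2
    rw [Real.sq_sqrt hκ.le] at h
    rw [foxArgument, ← Real.sqrt_eq_rpow, ← fadingScale, h]
    field_simp
  rw [outageTransform, Finset.prod_congr rfl fun k _ => hk k, Finset.prod_mul_distrib]
  simp only [Finset.prod_const, Finset.card_univ, Fintype.card_fin]
  ring

theorem lemma1 {Ω : Type*} [MeasurableSpace Ω] (P : Measure Ω) [IsProbabilityMeasure P]
    (K : ℕ) (hK : 1 ≤ K)
    (α μ φ S₀ hf R : ℝ) (hα : 0 < α) (hμ : 0 < μ) (hφ : 0 < φ) (hS₀ : 0 < S₀) (hhf : 0 < hf)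
    (hR : 0 < R)
    (hl : ℂ) (hhl : hl ≠ 0) (ρ : Fin K → ℝ) (hρ : ∀ k, 0 < ρ k)
    (hpf : Fin K → Ω → ℂ) (hmeas : ∀ k, Measurable (hpf k))
    (hindep : iIndepFun (fun k ω => ‖hpf k ω‖) P)
    (hpdf : ∀ k, Measure.map (fun ω => ‖hpf k ω‖) P =
      volume.withDensity (fun x => ENNReal.ofReal (fadingPDF α μ φ S₀ hf x))) :
    (∀ t : ℂ, 0 < t.re → ∀ k, FoxHWellDefined 1 3 (upperParams α μ φ t) (lowerParams φ)
        (foxArgument α μ S₀ hf hl (ρ k) : ℂ)) ∧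
      ∀ c : ℝ, 0 < c →
        IntegrableOnVerticalLine c (fun t =>
          outageTransform α μ φ S₀ hf hl ρ t * Complex.exp (R * t * Real.log 2)) ∧
        (outageProbability P ρ hl hpf R : ℂ) =
          (φ / (2 * Real.Gamma μ) : ℂ) ^ K *
            verticalLineIntegral c (fun t =>
              outageTransform α μ φ S₀ hf hl ρ t * Complex.exp (R * t * Real.log 2)) := by
  have hκ : ∀ k, 0 < ρ k * ‖hl‖ ^ 2 := fun k =>
    mul_pos (hρ k) (pow_pos (norm_pos_iff.2 hhl) 2)
  refine ⟨fun t ht k => ?_, fun c hc => ?_⟩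
  · have h := (foxHWellDefined_fading (α := α) hα hμ hφ hS₀ hhf ht (Real.sqrt_pos.2 (hκ k))).1
    rwa [foxArgument, ← Real.sqrt_eq_rpow, ← fadingScale]
  set X : Fin K → Ω → ℝ := fun k ω => roundInformation (ρ k * ‖hl‖ ^ 2) ‖hpf k ω‖ with hX
  set V : Ω → ℝ := fun ω => ∑ k, X k ω with hV
  have hXm : ∀ k, Measurable (X k) := fun k =>
    (measurable_roundInformation _).comp (hmeas k).norm
  have hVm : Measurable V := Finset.measurable_sum _ fun k _ => hXm k
  have hV0 : ∀ ω, 0 ≤ V ω := fun ω =>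
    Finset.sum_nonneg fun k _ => roundInformation_nonneg (hκ k).le _
  have hXind : iIndepFun X P :=
    hindep.comp (fun k => roundInformation (ρ k * ‖hl‖ ^ 2)) fun k => measurable_roundInformation _
  have hL : ∀ t : ℂ, ∫ ω, Complex.exp (-t * V ω) ∂P =
      ∏ k, fadingLaplace α μ φ S₀ hf (ρ k * ‖hl‖ ^ 2) t := fun t => by
    have h1 : ∀ ω, Complex.exp (-t * V ω) = ∏ k, Complex.exp (-t * X k ω) := fun ω => by
      rw [← Complex.exp_sum, ← Finset.mul_sum, hV, Complex.ofReal_sum]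
    simp only [h1]
    rw [hXind.integral_fun_prod_comp (X := X)
      (f := fun _ (x : ℝ) => Complex.exp (-t * x))
      (fun k => (hXm k).aemeasurable) (fun k => by fun_prop)]
    exact Finset.prod_congr rfl fun k _ =>
      integral_exp_roundInformation hα hμ hφ hS₀ hhf (hmeas k) (hpdf k) (hκ k).le t
  have hint := integrableOnVerticalLine_prod_fadingLaplace (α := α) hα hμ hφ hS₀ hhf hK hκ hc
  have hatom : P {ω | V ω = R * Real.log 2} = 0 :=
    measure_sum_eq_zero_of_iIndepFun hXm hXind ⟨0, hK⟩
      (measure_roundInformation_eq_zero (hmeas _) (hpdf _) (hκ _)) _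
  have hmain := measureReal_lt_eq_verticalLineIntegral hVm hV0 hc hatom (by simpa only [hL] using hint)
  simp only [hL] at hmain
  have hre : ∀ y : ℝ, ((c : ℂ) + y * Complex.I).re = c := fun y => by simp
  have htr : ∀ y : ℝ, outageTransform α μ φ S₀ hf hl ρ (c + y * Complex.I) *
      Complex.exp (R * (c + y * Complex.I) * Real.log 2) = (2 * Real.Gamma μ / φ) ^ K *
      ((∏ k, fadingLaplace α μ φ S₀ hf (ρ k * ‖hl‖ ^ 2) (c + y * Complex.I)) /
        (c + y * Complex.I) * Complex.exp ((c + y * Complex.I) * (R * Real.log 2 : ℝ))) :=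
    fun y => by
    rw [outageTransform_eq hα hμ hφ hS₀ hhf hhl hρ (by rwa [hre]), mul_assoc]
    congr 3
    push_cast; ring
  have hΓμ : (Real.Gamma μ : ℂ) ≠ 0 := by exact_mod_cast (Real.Gamma_pos_of_pos hμ).ne'
  have hφ0 : (φ : ℂ) ≠ 0 := by exact_mod_cast hφ.ne'
  constructor
  · unfold IntegrableOnVerticalLine at hint ⊢
    simp only [htr]
    refine Integrable.const_mul ?_ _
    -- The exponential has constant modulus along the line.
    refine hint.mul_bdd (c := Real.exp (c * (R * Real.log 2)))
      (by fun_prop : Continuous fun y : ℝ =>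
        Complex.exp ((c + y * Complex.I) * (R * Real.log 2 : ℝ))).aestronglyMeasurable
      (Filter.Eventually.of_forall fun y => ?_)
    rw [Complex.norm_exp, Complex.re_mul_ofReal, hre]
  · have hset : {ω | mutualInformation ρ hl hpf ω < R} = {ω | V ω < R * Real.log 2} := by
      ext ω
      have h2 : 0 < Real.log 2 := Real.log_pos one_lt_two
      have : mutualInformation ρ hl hpf ω = V ω / Real.log 2 := by
        simp only [mutualInformation, hV, hX, roundInformation, Real.logb, Finset.sum_div]
      rw [Set.mem_ofPred_eq, Set.mem_ofPred_eq, this, div_lt_iff₀ h2]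
    rw [outageProbability, hset, hmain, verticalLineIntegral_eq_smul,
      verticalLineIntegral_eq_smul]
    simp only [htr]
    rw [integral_const_mul, Complex.real_smul, Complex.real_smul, mul_left_comm, ← mul_assoc
      ((φ / (2 * Real.Gamma μ) : ℂ) ^ K), ← mul_pow]
    have : (φ / (2 * Real.Gamma μ) * (2 * Real.Gamma μ / φ) : ℂ) = 1 := by field_simp
    rw [this, one_pow, one_mul]
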